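/- \textbf{Setting.} Let $\beta>0$ and let $\varphi(x)=\frac{1}{2\beta^{1/\beta}\Gamma(1+1/\beta)}e^{-|x|^\beta/\beta}$, $x\in\mathbb R$, be the generalized $\beta$-Gaussian density. For $f:\mathbb R^s\to\mathbb R$ and $v\subseteq\{1,\dots,s\}$ let $\partial^v f$ be the (weak) mixed derivative of order one in each $x_j$, $j\in v$, let $\|f\|_{L^q(\mathbb R^s,\varphi)}^q=\int_{\mathbb R^s}|f|^q\prod_{j=1}^s\varphi(x_j)\,dx$, and let $W^{1,q}_{\mathrm{mix}}(\mathbb R^s,\varphi)$ be the space of $f$ with finite norm $\|f\|_{W^{1,q}_{\mathrm{mix}}(\mathbb R^s,\varphi)}=\big(\sum_{v\subseteq\{1,\dots,s\}}\|\partial^v f\|^q_{L^q(\mathbb R^s,\varphi)}\big)^{1/q}$. With $P_jf(x)=\int_{\mathbb R}f(x)\varphi(x_j)\,dx_j$, the ANOVA terms of $f$ are $f_v=\prod_{j\in v}(I-P_j)\prod_{j\notin v}P_j f$. Put $\|f\|_q=\sup_{v}\|f_v\|_{W^{1,q}_{\mathrm{mix}}(\mathbb R^s,\varphi)}$, and $\gamma_v=\|f\|_q^{-1}\|f_v\|_{W^{1,q}_{\mathrm{mix}}(\mathbb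 R^s,\varphi)}$ if $\|f\|_q>0$, $\gamma_v=0$ otherwise. A constant $PC_q>0$ is called a Poincaré constant if $\int_{\mathbb R}|h-\int h\varphi|^q\varphi\,dx\le PC_q\int_{\mathbb R}|h'|^q\varphi\,dx$ for all $h\in W^{1,q}(\mathbb R,\varphi)$. Let $D\subseteq\mathbb R^d$ be a bounded open set, $H^1_0(D)$ the closure of $C_c^\infty(D)$ in $H^1(D)$, normed by $\|u\|_{H^1_0(D)}=\|\nabla u\|_{L^2(D)}$, $H^{-1}(D)$ its dual, and $G\in H^{-1}(D)$. Let $0<\tau\le\beta$, $\sigma\ge1$, $q>1$, $K\in\mathbb R$, and let $(b_j)_{j\ge1}$, $(\alpha_j)_{j\ge1}$ be nonnegative real sequences with $\|\alpha\|_1=\sum_j\alpha_j<\infty$. If $\beta=\tau$, assume moreover that $q\beta\|\alpha\|_\infty<1$ (that is, $q\in(1,1/(\beta\|\alpha\|_\infty))$). \textbf{Theorem.} (i) If $\beta\ge1$, a Poincaré constant $PC_q$ exists. (ii) There is a constant $C>0$, depending only on the data fixed above (in particular not on $s$, $p$, $v$), such that the following holds for every $s$ and every $p:\mathbb R^s\to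 H^1_0(D)$ whose weak mixed derivatives exist and satisfy, for all $v\subseteq\{1,\dots,s\}$ and almost all $x$, $$\|\partial^v p(\cdot,x)\|_{H^1_0(D)}\le K\,(|v|!)^\sigma\Big(\prod_{j\in v}b_j\Big)\exp\Big\{\sum_{j=1}^s\alpha_j|x_j|^\tau\Big\}.$$ Let $f(x)=\langle G,p(\cdot,x)\rangle$. Then $f\in W^{1,q}_{\mathrm{mix}}(\mathbb R^s,\varphi)$ and $f_v\in W^{1,q}_{\mathrm{mix}}(\mathbb R^s,\varphi)$ for all $v$; if $f$ is not almost everywhere zero, then $\|f\|_q>0$. Furthermore, for every Poincaré constant $PC_q$, with $\Gamma_j=(PC_q+1)^{1/q}b_j$ (which is positive whenever $b_j>0$), for all $v\subseteq\{1,\dots,s\}$, $$\|f_v\|_{W^{1,q}_{\mathrm{mix}}(\mathbb R^s,\varphi)}\le C\,(|v|!)^\sigma\prod_{j\in v}\Gamma_j,$$ and, if $f$ is not almost everywhere zero, $$\gamma_v\le\frac{C}{\|f\|_q}\,(|v|!)^\sigma\prod_{j\in v}\Gamma_j .$$ -/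

import Mathlib

open MeasureTheory
open scoped ContDiff

noncomputable section

/-! ### The space `H₀¹(D)` and its dual -/

/-- The ambient Hilbert space `L²(D) × L²(D; ℝ^d)` with the norm
`(‖u‖² + ‖g‖²)^{1/2}`; a function `u ∈ H¹(D)` is represented by the pair `(u, ∇u)`. -/
abbrev L2Pair {d : ℕ} (D : Set (EuclideanSpace ℝ (Fin d))) : Type :=
  WithLp 2 (Lp ℝ 2 (volume.restrict D) × Lp (EuclideanSpace ℝ (Fin d)) 2 (volume.restrict D))

/-- The pairs `(u, ∇u)` with `u ∈ C_c^∞(D)`. -/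
def testPairs {d : ℕ} (D : Set (EuclideanSpace ℝ (Fin d))) : Set (L2Pair D) :=
  {w | ∃ u : EuclideanSpace ℝ (Fin d) → ℝ,
    ContDiff ℝ ∞ u ∧ HasCompactSupport u ∧ tsupport u ⊆ D ∧
    (w.fst : EuclideanSpace ℝ (Fin d) → ℝ) =ᵐ[volume.restrict D] u ∧
    (w.snd : EuclideanSpace ℝ (Fin d) → EuclideanSpace ℝ (Fin d))
      =ᵐ[volume.restrict D] fun y => gradient u y}

/-- `H₀¹(D)`: the closure of `C_c^∞(D)` in the `H¹(D)` norm. -/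
def H10 {d : ℕ} (D : Set (EuclideanSpace ℝ (Fin d))) : Submodule ℝ (L2Pair D) :=
  (Submodule.span ℝ (testPairs D)).topologicalClosure

instance {d : ℕ} (D : Set (EuclideanSpace ℝ (Fin d))) : CompleteSpace (H10 D) :=
  Submodule.topologicalClosure.completeSpace _

/-- The norm `‖u‖_{H₀¹(D)} = ‖∇u‖_{L²(D)}`. (As a subspace of `L2Pair D`, the type `H10 D` also
carries the full `H¹` norm, which is equivalent to this one for bounded `D`; the latter is only
used as the topology in which vector-valued integrals are taken.) -/
def H10.gradNorm {d : ℕ} {D : Set (EuclideanSpace ℝ (Fin d))} (u : H10 D) : ℝ :=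
  ‖(u : L2Pair D).snd‖

/-- `H⁻¹(D)`: the linear functionals on `H₀¹(D)` that are bounded for the norm `‖∇u‖_{L²(D)}`. -/
def HMinusOne {d : ℕ} (D : Set (EuclideanSpace ℝ (Fin d))) : Type :=
  {G : H10 D →ₗ[ℝ] ℝ // ∃ M : ℝ, ∀ u : H10 D, |G u| ≤ M * H10.gradNorm u}

/-- The duality pairing `⟨G, u⟩`. -/
def HMinusOne.pairing {d : ℕ} {D : Set (EuclideanSpace ℝ (Fin d))}
    (G : HMinusOne D) (u : H10 D) : ℝ := G.1 u

/-! ### Densities and the weighted measures -/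

/-- The generalized `β`-Gaussian density. -/
def betaDensity (β : ℝ) (x : ℝ) : ℝ :=
  1 / (2 * β ^ (1 / β) * Real.Gamma (1 + 1 / β)) * Real.exp (-(|x| ^ β / β))

/-- The measure `φ(x) dx` on `ℝ`. -/
def densityMeasure (φ : ℝ → ℝ) : Measure ℝ :=
  volume.withDensity fun x => ENNReal.ofReal (φ x)

/-- The measure `∏ⱼ φ(xⱼ) dx` on `ℝ^s`. -/
def productMeasure (φ : ℝ → ℝ) (s : ℕ) : Measure (Fin s → ℝ) :=
  Measure.pi fun _ => densityMeasure φ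

/-! ### Weak mixed derivatives and the mixed Sobolev space -/

/-- `∂^v ψ`, the first-order partial derivative in each variable `xⱼ`, `j ∈ v`
(used for smooth `ψ`, where the order of differentiation is irrelevant). -/
def mixedPartial {s : ℕ} (v : Finset (Fin s)) (ψ : (Fin s → ℝ) → ℝ) : (Fin s → ℝ) → ℝ :=
  (v.sort (· ≤ ·)).foldr (fun j g => fun x => fderiv ℝ g x (Pi.single j 1)) ψ

/-- `g` is the weak mixed derivative `∂^v f` on `ℝ^s`, for `f` with values in a Banach space. -/
def HasWeakMixedDeriv {s : ℕ} {E : Type*} [NormedAddCommGroup E] [NormedSpace ℝ E]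
    (v : Finset (Fin s)) (f g : (Fin s → ℝ) → E) : Prop :=
  LocallyIntegrable f volume ∧ LocallyIntegrable g volume ∧
    ∀ ψ : (Fin s → ℝ) → ℝ, ContDiff ℝ ∞ ψ → HasCompactSupport ψ →
      ∫ x, mixedPartial v ψ x • f x = (-1 : ℝ) ^ v.card • ∫ x, ψ x • g x

open Classical in
/-- A version of `∂^v f` (unique almost everywhere), and `0` if there is none. -/
def weakMixedDeriv {s : ℕ} (v : Finset (Fin s)) (f : (Fin s → ℝ) → ℝ) : (Fin s → ℝ) → ℝ :=
  if h : ∃ g, HasWeakMixedDeriv v f g then h.choose else 0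

/-- `f ∈ W^{1,q}_mix(ℝ^s, φ)`. -/
def MemWMix (φ : ℝ → ℝ) (q : ℝ) {s : ℕ} (f : (Fin s → ℝ) → ℝ) : Prop :=
  ∀ v : Finset (Fin s), ∃ g, HasWeakMixedDeriv v f g ∧
    MemLp g (ENNReal.ofReal q) (productMeasure φ s)

/-- The norm of `W^{1,q}_mix(ℝ^s, φ)` (meaningful for members of that space). -/
def mixNorm (φ : ℝ → ℝ) (q : ℝ) {s : ℕ} (f : (Fin s → ℝ) → ℝ) : ℝ :=
  (∑ v : Finset (Fin s), ∫ x, |weakMixedDeriv v f x| ^ q ∂(productMeasure φ s)) ^ (1 / q)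

/-! ### ANOVA decomposition -/

/-- `P_j f`, integration in the variable `x_j` against `φ`. -/
def anovaProj (φ : ℝ → ℝ) {s : ℕ} (j : Fin s) (f : (Fin s → ℝ) → ℝ) : (Fin s → ℝ) → ℝ :=
  fun x => ∫ t, f (Function.update x j t) ∂(densityMeasure φ)

/-- `P_w = ∏_{j ∈ w} P_j`. -/
def anovaProjSet (φ : ℝ → ℝ) {s : ℕ} (w : Finset (Fin s)) (f : (Fin s → ℝ) → ℝ) :
    (Fin s → ℝ) → ℝ :=
  (w.sort (· ≤ ·)).foldr (fun j g => anovaProj φ j g) f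

/-- The ANOVA term `f_v = (∏_{j ∈ v} (I - P_j)) P_{1:s \ v} f`. -/
def anovaTerm (φ : ℝ → ℝ) {s : ℕ} (v : Finset (Fin s)) (f : (Fin s → ℝ) → ℝ) :
    (Fin s → ℝ) → ℝ :=
  (v.sort (· ≤ ·)).foldr (fun j g => g - anovaProj φ j g) (anovaProjSet φ vᶜ f)

/-- `‖f‖_q = sup_v ‖f_v‖_{W^{1,q}_mix(ℝ^s, φ)}`. -/
def anovaSupNorm (φ : ℝ → ℝ) (q : ℝ) {s : ℕ} (f : (Fin s → ℝ) → ℝ) : ℝ :=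
  ⨆ v : Finset (Fin s), mixNorm φ q (anovaTerm φ v f)

open Classical in
/-- `γ_v = ‖f‖_q⁻¹ ‖f_v‖_{W^{1,q}_mix(ℝ^s, φ)}` if `‖f‖_q > 0`, and `0` otherwise. -/
def anovaWeight (φ : ℝ → ℝ) (q : ℝ) {s : ℕ} (f : (Fin s → ℝ) → ℝ) (v : Finset (Fin s)) : ℝ :=
  if 0 < anovaSupNorm φ q f then
    (anovaSupNorm φ q f)⁻¹ * mixNorm φ q (anovaTerm φ v f)
  else 0

/-! ### The one-dimensional Poincaré inequality -/

/-- `g` is the weak derivative of `f` on `ℝ`. -/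
def HasWeakDerivLine (f g : ℝ → ℝ) : Prop :=
  LocallyIntegrable f volume ∧ LocallyIntegrable g volume ∧
    ∀ ψ : ℝ → ℝ, ContDiff ℝ ∞ ψ → HasCompactSupport ψ →
      ∫ x, deriv ψ x * f x = -∫ x, ψ x * g x

/-- `φ` satisfies the generalized Poincaré inequality on `W^{1,q}(ℝ, φ)` with constant `P`. -/
def PoincareIneq (φ : ℝ → ℝ) (q P : ℝ) : Prop :=
  ∀ f g : ℝ → ℝ, HasWeakDerivLine f g →
    MemLp f (ENNReal.ofReal q) (densityMeasure φ) →
    MemLp g (ENNReal.ofReal q) (densityMeasure φ) →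
    ∫ x, |f x - ∫ y, f y ∂(densityMeasure φ)| ^ q ∂(densityMeasure φ)
      ≤ P * ∫ x, |g x| ^ q ∂(densityMeasure φ)

/-! ### The derivative bound on the parametric family -/

/-- The weak mixed derivatives of `x ↦ p(·, x)` exist and satisfy, for all `v ⊆ 1:s` and almost
all `x`, `‖∂^v p(·, x)‖_{H₀¹(D)} ≤ K (|v|!)^σ (∏_{j ∈ v} b_j) exp (∑_j α_j |x_j|^τ)`.
The sequences are indexed from `0`, so that `b j` stands for `b_{j+1}`. -/
def MixedDerivBound {d : ℕ} {D : Set (EuclideanSpace ℝ (Fin d))} {s : ℕ}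
    (p : (Fin s → ℝ) → H10 D) (K σ τ : ℝ) (b α : ℕ → ℝ) : Prop :=
  ∀ v : Finset (Fin s), ∃ dp : (Fin s → ℝ) → H10 D,
    HasWeakMixedDeriv v p dp ∧
    ∀ᵐ x : Fin s → ℝ, H10.gradNorm (dp x) ≤
      K * (v.card.factorial : ℝ) ^ σ * (∏ j ∈ v, b j) * Real.exp (∑ j : Fin s, α j * |x j| ^ τ)

end

open Function

/-! The estimate rests on how derivatives interact with the ANOVA factors. The derivative `∂_i`
annihilates the range of `P_i` and commutes with `P_j` for `j ≠ i`. Hence `∂^u f_v` vanishes unless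
`u ⊆ v`, and for `u ⊆ v` it is `∏_{j ∈ v \ u} (I - P_j)` applied to `P_{vᶜ} ∂^u f`. The Poincaré
inequality, used once in each direction of `v \ u`, costs `P ^ |v \ u|` and raises `∂^u f` to `∂^v
f`; by Jensen, each `P_j` is a contraction of `L^q`. Summing over `u ⊆ v`, the binomial formula
gives `‖f_v‖^q ≤ (P + 1) ^ |v| * ‖∂^v f‖_q^q` (`MixChain.mixNorm_anovaTerm_le`).

It remains to bound `∂^v f = ⟨G, ∂^v p⟩` in `L^q`. The `q`-th power of the exponential weight
factorises over coordinates, and convexity of `exp` bounds the `j`-th factor by `exp (c * α j)` with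
one constant `c`, so the product is at most `exp (c * ∑ α j)` for every `s` (`integral_exp_sum_le`).

Weak derivatives are handled through absolute continuity on lines (`HasSliceDeriv`), a form that is
stable under `P_j` by Fubini. The passage from weak derivatives to lines is
`hasSliceDeriv_of_integral_prod_test`: `f` minus the slice primitive of its derivative equals its
own average in that direction.

If `f` is not almost everywhere zero, some ANOVA term is nonzero, because `g = (g - P_j g) + P_j g`
recovers `f` from its terms coordinate by coordinate. The Poincaré constant for `β ≥ 1` comes from
Young's convolution inequality: on the segment from `0` to `x`, `φ(x) ≤ e^{1-|x-t|} φ(t)`, so the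
weighted primitive of `g` is dominated by a convolution with an integrable kernel. -/

/-! ### Product measures and single-coordinate updates -/

/-- Exchanging the `i`-th coordinate of `x` with an independent copy `t` preserves the measure. -/
theorem measurePreserving_update_swap {ι : Type*} [Fintype ι] [DecidableEq ι] (ν : Measure ℝ)
    [SigmaFinite ν] (i : ι) :
    MeasurePreserving (fun z : (ι → ℝ) × ℝ => (update z.1 i z.2, z.1 i))
      ((Measure.pi fun _ : ι => ν).prod ν) ((Measure.pi fun _ : ι => ν).prod ν) := by
  have hm : Measurable (fun z : (ι → ℝ) × ℝ => (update z.1 i z.2, z.1 i)) :=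
    measurable_update'.prodMk ((measurable_pi_apply i).comp measurable_fst)
  -- It suffices to test rectangles `A × B`: the swap exchanges the factor `A i` with `B`, which
  -- leaves the product of masses unchanged.
  refine ⟨hm, (Measure.prod_eq_generateFrom generateFrom_pi
    MeasurableSpace.generateFrom_measurableSet isPiSystem_pi
    MeasurableSpace.isPiSystem_measurableSet
    (Measure.FiniteSpanningSetsIn.pi fun _ => ν.toFiniteSpanningSetsIn)
    ν.toFiniteSpanningSetsIn ?_).symm⟩
  rintro _ ⟨A, hA, rfl⟩ B hB
  have hA' : ∀ j, MeasurableSet (A j) := fun j => hA j (Set.mem_univ j)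
  rw [Measure.map_apply hm ((MeasurableSet.univ_pi hA').prod hB)]
  have : (fun z : (ι → ℝ) × ℝ => (update z.1 i z.2, z.1 i)) ⁻¹' (Set.pi Set.univ A ×ˢ B)
      = (Set.pi Set.univ (update A i B)) ×ˢ (A i) := by
    ext ⟨x, t⟩
    simp only [Set.mem_preimage, Set.mem_prod, Set.mem_pi, Set.mem_univ, true_imp_iff]
    constructor
    · rintro ⟨h1, h2⟩
      refine ⟨fun j => ?_, by simpa using h1 i⟩
      by_cases hj : j = i
      · subst hj; simpa using h2
      · simpa [hj] using h1 j
    · rintro ⟨h1, h2⟩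
      refine ⟨fun j => ?_, by simpa using h1 i⟩
      by_cases hj : j = i
      · subst hj; simpa using h2
      · simpa [hj] using h1 j
  rw [this, Measure.prod_prod, Measure.pi_pi, Measure.pi_pi]
  rw [← Finset.mul_prod_erase _ _ (Finset.mem_univ i),
    ← Finset.mul_prod_erase Finset.univ (fun j => ν (A j)) (Finset.mem_univ i)]
  rw [Finset.prod_congr rfl (g := fun j => ν (A j))]
  · simp only [update_self]; ring
  · intro j hj
    rw [update_of_ne (Finset.ne_of_mem_erase hj)]

/-- Resampling one coordinate is the first component of the swap; forgetting the old coordinate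
preserves the measure because `ν` has mass one. This is the Fubini input for all statements about
`P_i`. -/
theorem measurePreserving_update {ι : Type*} [Fintype ι] [DecidableEq ι] (ν : Measure ℝ)
    [IsProbabilityMeasure ν] (i : ι) :
    MeasurePreserving (fun z : (ι → ℝ) × ℝ => update z.1 i z.2)
      ((Measure.pi fun _ : ι => ν).prod ν) (Measure.pi fun _ : ι => ν) :=
  measurePreserving_fst.comp (measurePreserving_update_swap ν i)

/-- A continuous, everywhere positive probability density. -/
structure IsPosDensity (φ : ℝ → ℝ) : Prop where
  continuous : Continuous φ
  pos : ∀ x, 0 < φ x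
  prob : IsProbabilityMeasure (densityMeasure φ)

namespace IsPosDensity

variable {φ : ℝ → ℝ}

theorem integrable (hφ : IsPosDensity φ) : Integrable φ := by
  have := hφ.prob
  refine ⟨hφ.continuous.aestronglyMeasurable, ?_⟩
  have h := measure_lt_top (densityMeasure φ) Set.univ
  rw [densityMeasure, withDensity_apply _ MeasurableSet.univ, Measure.restrict_univ] at h
  rw [hasFiniteIntegral_iff_ofReal (Filter.Eventually.of_forall fun x => (hφ.pos x).le)]
  exact h

theorem volume_ac (hφ : IsPosDensity φ) : (volume : Measure ℝ) ≪ densityMeasure φ :=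
  withDensity_absolutelyContinuous' (by have := hφ.continuous; fun_prop)
    (Filter.Eventually.of_forall fun x => by simpa using hφ.pos x)

theorem ac_volume (φ : ℝ → ℝ) : densityMeasure φ ≪ (volume : Measure ℝ) :=
  withDensity_absolutelyContinuous _ _

theorem prod_continuous (hc : Continuous φ) (s : ℕ) :
    Continuous fun x : Fin s → ℝ => ∏ j, φ (x j) := by
  fun_prop

theorem productMeasure_eq (hφ : IsPosDensity φ) (s : ℕ) : productMeasure φ s =
    volume.withDensity fun x : Fin s → ℝ => ENNReal.ofReal (∏ j, φ (x j)) := by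
  have := hφ.prob
  refine Measure.pi_eq fun A hA => ?_
  rw [withDensity_apply _ (MeasurableSet.univ_pi hA), volume_pi, Measure.restrict_pi_pi,
    ← ofReal_integral_eq_lintegral_ofReal, integral_fintype_prod_eq_prod (fun _ => φ),
    ENNReal.ofReal_prod_of_nonneg]
  · refine Finset.prod_congr rfl fun j _ => ?_
    rw [densityMeasure, withDensity_apply _ (hA j), ofReal_integral_eq_lintegral_ofReal
      hφ.integrable.restrict (Filter.Eventually.of_forall fun x => (hφ.pos x).le)]
  · exact fun j _ => integral_nonneg fun x => (hφ.pos x).le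
  · exact Integrable.fintype_prod (f := fun _ => φ) fun j => hφ.integrable.restrict
  · exact Filter.Eventually.of_forall fun x => Finset.prod_nonneg fun j _ => (hφ.pos _).le

/-- Weak derivatives refer to Lebesgue measure and norms to the weighted one; positivity of `φ`
makes the null sets the same. -/
theorem volume_ac_product (hφ : IsPosDensity φ) (s : ℕ) : (volume : Measure (Fin s → ℝ)) ≪ productMeasure φ s := by
  rw [hφ.productMeasure_eq]
  have hc := prod_continuous hφ.continuous s
  refine withDensity_absolutelyContinuous' ?_ ?_
  · exact (ENNReal.continuous_ofReal.comp hc).measurable.aemeasurable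
  · exact Filter.Eventually.of_forall fun x => by
      simpa using Finset.prod_pos fun j _ => hφ.pos (x j)

theorem product_ac_volume (hφ : IsPosDensity φ) (s : ℕ) : productMeasure φ s ≪ (volume : Measure (Fin s → ℝ)) := by
  rw [hφ.productMeasure_eq]
  exact withDensity_absolutelyContinuous _ _

theorem product_prob (hφ : IsPosDensity φ) (s : ℕ) : IsProbabilityMeasure (productMeasure φ s) := by
  have := hφ.prob
  unfold productMeasure
  infer_instance

/-- The weight is removed by multiplying with the continuous, hence locally bounded, function `1 /
w`. -/
theorem locallyIntegrable_of_integrable_withDensity {X : Type*} [TopologicalSpace X]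
    [MeasurableSpace X] [OpensMeasurableSpace X] [LocallyCompactSpace X] [T2Space X]
    [SecondCountableTopology X]
    {m : Measure X} {w f : X → ℝ} (hw : Continuous w) (hpos : ∀ x, 0 < w x)
    (hf : Integrable f (m.withDensity fun x => ENNReal.ofReal (w x))) : LocallyIntegrable f m := by
  rw [integrable_withDensity_iff_integrable_smul' (by fun_prop) (by simp)] at hf
  have h := hf.locallyIntegrable.continuous_smul (g := fun x => (w x)⁻¹)
    (hw.inv₀ fun x => (hpos x).ne')
  refine h.congr (Filter.Eventually.of_forall fun x => ?_)
  have := (hpos x).ne'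
  simp [ENNReal.toReal_ofReal (hpos x).le, this]

theorem locallyIntegrable (hφ : IsPosDensity φ) {f : ℝ → ℝ} (hf : Integrable f (densityMeasure φ)) :
    LocallyIntegrable f :=
  locallyIntegrable_of_integrable_withDensity hφ.continuous hφ.pos hf

theorem locallyIntegrable_product (hφ : IsPosDensity φ) {s : ℕ} {f : (Fin s → ℝ) → ℝ}
    (hf : Integrable f (productMeasure φ s)) : LocallyIntegrable f := by
  rw [hφ.productMeasure_eq] at hf
  exact locallyIntegrable_of_integrable_withDensity (prod_continuous hφ.continuous s)
    (fun x => Finset.prod_pos fun j _ => hφ.pos _) hf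

end IsPosDensity

/-! ### Weak derivatives on the line -/

theorem exists_support_subset_Ioo {ψ : ℝ → ℝ} (hc : HasCompactSupport ψ) (a : ℝ) :
    ∃ N : ℝ, |a| < N ∧ tsupport ψ ⊆ Set.Ioo (-N) N := by
  obtain ⟨R, hR⟩ := hc.isCompact.isBounded.subset_ball (0 : ℝ)
  refine ⟨max R (|a| + 1), lt_of_lt_of_le (by linarith) (le_max_right _ _), fun x hx => ?_⟩
  have := hR hx
  rw [Metric.mem_ball, dist_zero_right, Real.norm_eq_abs] at this
  exact abs_lt.mp (this.trans_le (le_max_left _ _))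

/-- The primitive started to the left of the support also vanishes to its right, because the total
integral is zero. -/
theorem exists_compact_primitive {ψ : ℝ → ℝ} (hψ : ContDiff ℝ ∞ ψ) (hc : HasCompactSupport ψ)
    (h0 : ∫ x, ψ x = 0) :
    ∃ Ψ : ℝ → ℝ, ContDiff ℝ ∞ Ψ ∧ HasCompactSupport Ψ ∧ deriv Ψ = ψ := by
  obtain ⟨N, hN, hsupp⟩ := exists_support_subset_Ioo hc 0
  have hN0 : 0 < N := by simpa using hN
  have hzero : ∀ x, x ∉ Set.Ioo (-N) N → ψ x = 0 := fun x hx =>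
    image_eq_zero_of_notMem_tsupport fun h => hx (hsupp h)
  have hd : ∀ x, HasDerivAt (fun t => ∫ r in (-N)..t, ψ r) (ψ x) x := fun x =>
    intervalIntegral.integral_hasDerivAt_right (hψ.continuous.intervalIntegrable _ _)
      (hψ.continuous.stronglyMeasurableAtFilter _ _) hψ.continuous.continuousAt
  have hderiv : deriv (fun t => ∫ r in (-N)..t, ψ r) = ψ := funext fun x => (hd x).deriv
  refine ⟨fun t => ∫ r in (-N)..t, ψ r, ?_, ?_, hderiv⟩
  · rw [contDiff_infty_iff_deriv, hderiv]
    exact ⟨fun x => (hd x).differentiableAt, hψ⟩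
  · refine HasCompactSupport.intro (isCompact_Icc (a := -N) (b := N)) fun x hx => ?_
    simp only [Set.mem_Icc, not_and_or, not_le] at hx
    rcases hx with hx | hx
    · rw [intervalIntegral.integral_congr (g := fun _ => 0)]
      · simp
      · intro r hr
        rw [Set.uIcc_of_ge hx.le] at hr
        exact hzero r fun h => absurd h.1 (not_lt.mpr hr.2)
    · rw [intervalIntegral.integral_eq_integral_of_support_subset, h0]
      intro r hr
      have : r ∈ Set.Ioo (-N) N := by
        by_contra h
        exact hr (hzero r h)
      exact ⟨this.1, (this.2.trans hx).le⟩

theorem exists_test_integral_one : ∃ ρ : ℝ → ℝ, ContDiff ℝ ∞ ρ ∧ HasCompactSupport ρ ∧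
    ∫ x, ρ x = 1 := by
  let b : ContDiffBump (0 : ℝ) := ⟨1, 2, by norm_num, by norm_num⟩
  exact ⟨b.normed volume, b.contDiff_normed, b.hasCompactSupport_normed, b.integral_normed⟩

theorem intervalIntegrable_of_locallyIntegrable {g : ℝ → ℝ} (hg : LocallyIntegrable g) (a b : ℝ) :
    IntervalIntegrable g volume a b :=
  (hg.integrableOn_isCompact isCompact_uIcc).intervalIntegrable

theorem locallyIntegrable_primitive {g : ℝ → ℝ} (hg : LocallyIntegrable g) (a : ℝ) :
    LocallyIntegrable fun t => ∫ r in a..t, g r :=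
  (intervalIntegral.continuous_primitive (fun _ _ => intervalIntegrable_of_locallyIntegrable hg _ _) a).locallyIntegrable

/-- Integration by parts for absolutely continuous functions on `[-N, N]`. The interval contains the
base point `a` and the support of `ψ`, so there are no boundary terms. -/
theorem integral_deriv_mul_primitive {g : ℝ → ℝ} (hg : LocallyIntegrable g) (a c : ℝ) {ψ : ℝ → ℝ}
    (hψ : ContDiff ℝ ∞ ψ) (hc : HasCompactSupport ψ) :
    ∫ t, deriv ψ t * (c + ∫ r in a..t, g r) = -∫ t, ψ t * g t := by
  obtain ⟨N, hN, hsupp⟩ := exists_support_subset_Ioo hc a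
  have hN0 : 0 < N := (abs_nonneg a).trans_lt hN
  have hzero : ∀ x, x ∉ Set.Ioo (-N) N → ψ x = 0 := fun x hx =>
    image_eq_zero_of_notMem_tsupport fun h => hx (hsupp h)
  have hzero' : ∀ x, x ∉ Set.Ioo (-N) N → deriv ψ x = 0 := fun x hx =>
    image_eq_zero_of_notMem_tsupport fun h => hx (hsupp (tsupport_deriv_subset (𝕜 := ℝ) h))
  have hsub : ∀ f : ℝ → ℝ, (∀ x, x ∉ Set.Ioo (-N) N → f x = 0) →
      ∫ x, f x = ∫ x in (-N)..N, f x := fun f hf => by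
    rw [intervalIntegral.integral_eq_integral_of_support_subset]
    intro x hx
    have : x ∈ Set.Ioo (-N) N := by
      by_contra h
      exact hx (hf x h)
    exact ⟨this.1, this.2.le⟩
  rw [hsub _ fun x hx => by rw [hzero' x hx, zero_mul],
    hsub _ fun x hx => by rw [hzero x hx, zero_mul]]
  have hF : AbsolutelyContinuousOnInterval (fun t => c + ∫ r in a..t, g r) (-N) N := by
    have h1 := (intervalIntegrable_of_locallyIntegrable hg (-N) N).absolutelyContinuousOnInterval_intervalIntegral
      (c := a) (by
        rw [Set.uIcc_of_le (by linarith)]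
        exact ⟨(abs_lt.mp hN).1.le, (abs_lt.mp hN).2.le⟩)
    have h2 : AbsolutelyContinuousOnInterval (fun _ : ℝ => c) (-N) N :=
      ContDiffOn.absolutelyContinuousOnInterval contDiffOn_const
    exact h2.add h1
  have hψac : AbsolutelyContinuousOnInterval ψ (-N) N :=
    ContDiffOn.absolutelyContinuousOnInterval
      (hψ.of_le (by exact_mod_cast le_top)).contDiffOn
  have key := hF.integral_mul_deriv_eq_deriv_mul hψac
  rw [hzero N (by simp), hzero (-N) (by simp)] at key
  simp_rw [mul_comm (deriv ψ _)]
  rw [key, mul_zero, mul_zero, sub_zero, zero_sub]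
  congr 1
  refine intervalIntegral.integral_congr_ae ?_
  filter_upwards [LocallyIntegrable.ae_hasDerivAt_integral hg] with x hx _
  rw [((hx a).const_add c).deriv, mul_comm]

theorem hasWeakDerivLine_primitive {g : ℝ → ℝ} (hg : LocallyIntegrable g) (a c : ℝ) :
    HasWeakDerivLine (fun t => c + ∫ r in a..t, g r) g :=
  ⟨(locallyIntegrable_const c).add (locallyIntegrable_primitive hg a), hg,
    fun _ hψ hc => integral_deriv_mul_primitive hg a c hψ hc⟩

theorem HasWeakDerivLine.congr_ae {f f' g : ℝ → ℝ} (h : HasWeakDerivLine f g) (hf : f =ᵐ[volume] f') :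
    HasWeakDerivLine f' g := by
  refine ⟨h.1.congr hf, h.2.1, fun ψ hψ hc => ?_⟩
  rw [← h.2.2 ψ hψ hc]
  refine integral_congr_ae ?_
  filter_upwards [hf] with x hx
  rw [hx]

theorem integrable_test_mul {X : Type*} [TopologicalSpace X] [T2Space X] [MeasurableSpace X]
    [OpensMeasurableSpace X] {m : Measure X} {f ψ : X → ℝ} (hf : LocallyIntegrable f m)
    (hψ : Continuous ψ) (hc : HasCompactSupport ψ) : Integrable (fun x => ψ x * f x) m := by
  simpa using hf.integrable_smul_left_of_hasCompactSupport hψ hc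

/-- A function whose distributional derivative vanishes is almost everywhere constant. -/
theorem ae_eq_const_of_integral_deriv_mul_eq_zero {K : ℝ → ℝ} (hK : LocallyIntegrable K)
    (h : ∀ ψ : ℝ → ℝ, ContDiff ℝ ∞ ψ → HasCompactSupport ψ → ∫ x, deriv ψ x * K x = 0) :
    ∃ c : ℝ, K =ᵐ[volume] fun _ => c := by
  obtain ⟨ρ, hρ, hρc, hρ1⟩ := exists_test_integral_one
  refine ⟨∫ x, ρ x * K x, ae_eq_of_integral_contDiff_smul_eq hK (locallyIntegrable_const _)
    fun ψ hψ hc => ?_⟩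
  have hψi := hψ.continuous.integrable_of_hasCompactSupport hc (μ := volume)
  have hρi := hρ.continuous.integrable_of_hasCompactSupport hρc (μ := volume)
  -- Subtracting `(∫ ψ) ρ` removes the mean, so the remainder is the derivative of a test function
  -- and is annihilated by `K`.
  obtain ⟨Ψ, hΨ, hΨc, hΨd⟩ := exists_compact_primitive
    (ψ := fun x => ψ x - (∫ y, ψ y) * ρ x) (hψ.sub (contDiff_const.mul hρ))
    (hc.sub (hρc.mul_left)) (by
      rw [integral_sub hψi (hρi.const_mul _), integral_const_mul, hρ1]
      simp)
  have h0 := h Ψ hΨ hΨc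
  simp only [hΨd, sub_mul, mul_assoc] at h0
  rw [integral_sub (integrable_test_mul hK hψ.continuous hc)
    ((integrable_test_mul hK hρ.continuous hρc).const_mul _), integral_const_mul] at h0
  simp only [smul_eq_mul]
  rw [integral_mul_const]
  linarith

theorem HasWeakDerivLine.exists_ae_eq_primitive {f g : ℝ → ℝ} (h : HasWeakDerivLine f g) :
    ∃ c : ℝ, f =ᵐ[volume] fun t => c + ∫ r in (0 : ℝ)..t, g r := by
  obtain ⟨hf, hg, hw⟩ := h
  have hG := locallyIntegrable_primitive hg 0
  obtain ⟨c, hc⟩ := ae_eq_const_of_integral_deriv_mul_eq_zero (hf.sub hG) fun ψ hψ hc => by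
    have h1 := hw ψ hψ hc
    have h2 := integral_deriv_mul_primitive hg 0 0 hψ hc
    have hd : Continuous (deriv ψ) := hψ.continuous_deriv (by simp)
    simp only [zero_add] at h2
    simp only [Pi.sub_apply, mul_sub]
    rw [integral_sub (integrable_test_mul hf hd hc.deriv) (integrable_test_mul hG hd hc.deriv),
      h1, h2, sub_self]
  refine ⟨c, ?_⟩
  filter_upwards [hc] with t ht
  rw [← ht]
  simp

/-! ### Tensor products of test functions -/

section TestFunctions

variable {s : ℕ}

theorem contDiff_prod_test {χ : Fin s → ℝ → ℝ} (h : ∀ j, ContDiff ℝ ∞ (χ j)) :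
    ContDiff ℝ ∞ fun x : Fin s → ℝ => ∏ j, χ j (x j) :=
  contDiff_prod fun j _ => (h j).comp (contDiff_apply ℝ ℝ j)

theorem continuous_prod_test {χ : Fin s → ℝ → ℝ} (h : ∀ j, Continuous (χ j)) :
    Continuous fun x : Fin s → ℝ => ∏ j, χ j (x j) :=
  continuous_finsetProd _ fun j _ => (h j).comp (continuous_apply j)

theorem hasCompactSupport_prod_test {χ : Fin s → ℝ → ℝ} (h : ∀ j, HasCompactSupport (χ j)) :
    HasCompactSupport fun x : Fin s → ℝ => ∏ j, χ j (x j) := by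
  refine HasCompactSupport.intro (isCompact_univ_pi fun j => (h j).isCompact) fun x hx => ?_
  simp only [Set.mem_pi, Set.mem_univ, true_imp_iff, not_forall] at hx
  obtain ⟨j, hj⟩ := hx
  exact Finset.prod_eq_zero (Finset.mem_univ j) (image_eq_zero_of_notMem_tsupport hj)

theorem prod_update_eq {χ : Fin s → ℝ → ℝ} (i : Fin s) (u : ℝ → ℝ) (x : Fin s → ℝ) (t : ℝ) :
    ∏ j, (update χ i u) j (update x i t j) = u t * ∏ j ∈ Finset.univ.erase i, χ j (x j) := by
  rw [← Finset.mul_prod_erase _ _ (Finset.mem_univ i)]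
  simp only [update_self]
  congr 1
  refine Finset.prod_congr rfl fun j hj => ?_
  rw [update_of_ne (Finset.ne_of_mem_erase hj), update_of_ne (Finset.ne_of_mem_erase hj)]

theorem prod_update_fun_eq {χ : Fin s → ℝ → ℝ} (i : Fin s) (u : ℝ → ℝ) (x : Fin s → ℝ) :
    ∏ j, (update χ i u) j (x j) = u (x i) * ∏ j ∈ Finset.univ.erase i, χ j (x j) := by
  simpa using prod_update_eq (χ := χ) i u x (x i)

theorem prod_update_arg_eq {χ : Fin s → ℝ → ℝ} (i : Fin s) (x : Fin s → ℝ) (t : ℝ) :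
    ∏ j, χ j (update x i t j) = χ i t * ∏ j ∈ Finset.univ.erase i, χ j (x j) := by
  simpa using prod_update_eq (χ := χ) i (χ i) x t

theorem prod_test_eq {χ : Fin s → ℝ → ℝ} (i : Fin s) (x : Fin s → ℝ) :
    ∏ j, χ j (x j) = χ i (x i) * ∏ j ∈ Finset.univ.erase i, χ j (x j) := by
  simpa using prod_update_arg_eq (χ := χ) i x (x i)

theorem hasDerivAt_comp_update {ψ : (Fin s → ℝ) → ℝ} (hψ : Differentiable ℝ ψ) (x : Fin s → ℝ)
    (i : Fin s) (t : ℝ) :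
    HasDerivAt (fun r => ψ (update x i r)) (fderiv ℝ ψ (update x i t) (Pi.single i 1)) t :=
  (hψ (update x i t)).hasFDerivAt.comp_hasDerivAt t (hasDerivAt_update x i t)

theorem fderiv_prod_test {χ : Fin s → ℝ → ℝ} (h : ∀ j, ContDiff ℝ ∞ (χ j)) (i : Fin s)
    (x : Fin s → ℝ) :
    fderiv ℝ (fun x : Fin s → ℝ => ∏ j, χ j (x j)) x (Pi.single i 1)
      = ∏ j, (update χ i (deriv (χ i))) j (x j) := by
  have h1 := hasDerivAt_comp_update ((contDiff_prod_test h).differentiable (by simp)) x i (x i)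
  rw [update_eq_self] at h1
  simp only [prod_update_arg_eq i x] at h1
  rw [← h1.deriv, prod_update_fun_eq]
  exact ((((h i).differentiable (by simp)) (x i)).hasDerivAt.mul_const _).deriv

/-- `Nodup` guarantees that no factor is differentiated twice. -/
theorem foldr_fderiv_prod_test (l : List (Fin s)) (hl : l.Nodup) {χ : Fin s → ℝ → ℝ}
    (h : ∀ j, ContDiff ℝ ∞ (χ j)) :
    l.foldr (fun j g => fun x => fderiv ℝ g x (Pi.single j 1))
        (fun x : Fin s → ℝ => ∏ j, χ j (x j))
      = fun x => ∏ j, (if j ∈ l then deriv (χ j) else χ j) (x j) := by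
  induction l with
  | nil => simp
  | cons i l ih =>
    rw [List.nodup_cons] at hl
    have hs : ∀ j, ContDiff ℝ ∞ (if j ∈ l then deriv (χ j) else χ j) := fun j => by
      split_ifs
      · exact (contDiff_infty_iff_deriv.mp (h j)).2
      · exact h j
    rw [List.foldr_cons, ih hl.2]
    funext x
    rw [fderiv_prod_test (χ := fun j => if j ∈ l then deriv (χ j) else χ j) hs i x]
    refine Finset.prod_congr rfl fun j _ => ?_
    by_cases hj : j = i
    · subst hj; simp [hl.1]
    · simp [hj]

/-- On tensor products the order of differentiation drops out, so mixed derivatives over different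
index sets can be compared factor by factor. -/
theorem mixedPartial_prod_test (v : Finset (Fin s)) {χ : Fin s → ℝ → ℝ}
    (h : ∀ j, ContDiff ℝ ∞ (χ j)) :
    mixedPartial v (fun x : Fin s → ℝ => ∏ j, χ j (x j))
      = fun x => ∏ j, (if j ∈ v then deriv (χ j) else χ j) (x j) := by
  unfold mixedPartial
  rw [foldr_fderiv_prod_test _ (Finset.sort_nodup _ _) h]
  simp

/-- Take `smoothTransition (n * u t)` with `u ≥ 0` smooth and supported exactly on the interval: it
equals `1` as soon as `n * u t ≥ 1`. -/
theorem exists_test_seq_tendsto_indicator_Ioo (a b : ℝ) : ∃ χ : ℕ → ℝ → ℝ,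
    (∀ n, ContDiff ℝ ∞ (χ n)) ∧ (∀ n, HasCompactSupport (χ n)) ∧
    (∀ n t, ‖χ n t‖ ≤ (Set.Ioo a b).indicator 1 t) ∧
    ∀ t, Filter.Tendsto (fun n => χ n t) Filter.atTop (nhds ((Set.Ioo a b).indicator 1 t)) := by
  obtain ⟨u, hu, hud, hur⟩ := (isOpen_Ioo (a := a) (b := b)).exists_contDiff_support_eq (n := ⊤)
  have hu0 : ∀ t, t ∉ Set.Ioo a b → u t = 0 := fun t ht => by
    rw [← hu] at ht
    simpa using ht
  refine ⟨fun n t => Real.smoothTransition (n * u t), fun n => ?_, fun n => ?_, fun n t => ?_,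
    fun t => ?_⟩
  · exact Real.smoothTransition.contDiff.comp (contDiff_const.mul hud)
  · refine HasCompactSupport.intro (isCompact_Icc (a := a) (b := b)) fun t ht => ?_
    simp [hu0 t fun h => ht (Set.Ioo_subset_Icc_self h)]
  · by_cases ht : t ∈ Set.Ioo a b
    · rw [Set.indicator_of_mem ht, Real.norm_of_nonneg (Real.smoothTransition.nonneg _)]
      exact Real.smoothTransition.le_one _
    · simp [hu0 t ht, ht]
  · by_cases ht : t ∈ Set.Ioo a b
    · have hpos : 0 < u t := by
        refine lt_of_le_of_ne (hur ⟨t, rfl⟩).1 (Ne.symm ?_)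
        rw [← hu] at ht
        exact ht
      obtain ⟨n, hn⟩ := exists_nat_ge (1 / u t)
      refine tendsto_const_nhds.congr' ?_
      filter_upwards [Filter.eventually_ge_atTop n] with m hm
      rw [Set.indicator_of_mem ht, Real.smoothTransition.one_of_one_le, Pi.one_apply]
      rw [div_le_iff₀ hpos] at hn
      exact hn.trans (mul_le_mul_of_nonneg_right (by exact_mod_cast hm) hpos.le)
    · simp [hu0 t ht, ht]

theorem prod_indicator_eq_indicator_pi (A : Fin s → Set ℝ) (x : Fin s → ℝ) :
    ∏ j, (A j).indicator (1 : ℝ → ℝ) (x j) = (Set.univ.pi A).indicator 1 x := by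
  by_cases hx : x ∈ Set.univ.pi A
  · rw [Set.indicator_of_mem hx]
    exact Finset.prod_eq_one fun j _ => Set.indicator_of_mem (hx j (Set.mem_univ j)) _
  · rw [Set.indicator_of_notMem hx]
    simp only [Set.mem_pi, Set.mem_univ, true_imp_iff, not_forall] at hx
    obtain ⟨j, hj⟩ := hx
    exact Finset.prod_eq_zero (Finset.mem_univ j) (Set.indicator_of_notMem hj _)

/-- Tensor products of the cut-offs above converge to the indicator of the box, dominated by `|K|`
on that box. -/
theorem setIntegral_box_eq_zero {K : (Fin s → ℝ) → ℝ} (hK : LocallyIntegrable K)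
    (h : ∀ χ : Fin s → ℝ → ℝ, (∀ j, ContDiff ℝ ∞ (χ j)) → (∀ j, HasCompactSupport (χ j)) →
      ∫ x, (∏ j, χ j (x j)) * K x = 0) (a b : Fin s → ℝ) :
    ∫ x in Set.univ.pi fun j => Set.Ioo (a j) (b j), K x = 0 := by
  choose χ hd hc hle hlim using exists_test_seq_tendsto_indicator_Ioo
  have hmeas : MeasurableSet (Set.univ.pi fun j => Set.Ioo (a j) (b j)) :=
    MeasurableSet.univ_pi fun j => measurableSet_Ioo
  have hKb : IntegrableOn K (Set.univ.pi fun j => Set.Ioo (a j) (b j)) :=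
    (hK.integrableOn_isCompact (isCompact_univ_pi fun j => isCompact_Icc (a := a j) (b := b j))).mono_set
      (Set.pi_mono fun j _ => Set.Ioo_subset_Icc_self)
  have hT : Filter.Tendsto (fun n : ℕ => ∫ x, (∏ j, χ (a j) (b j) n (x j)) * K x) Filter.atTop
      (nhds (∫ x, (Set.univ.pi fun j => Set.Ioo (a j) (b j)).indicator 1 x * K x)) := by
    refine tendsto_integral_of_dominated_convergence
      (fun x => (Set.univ.pi fun j => Set.Ioo (a j) (b j)).indicator (fun x => ‖K x‖) x)
      (fun n => ?_) ?_ (fun n => ?_) ?_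
    · exact (continuous_prod_test fun j => (hd _ _ n).continuous).aestronglyMeasurable.mul
        hK.aestronglyMeasurable
    · exact IntegrableOn.integrable_indicator (f := fun x => ‖K x‖) (Integrable.norm hKb) hmeas
    · refine Filter.Eventually.of_forall fun x => ?_
      rw [norm_mul, norm_prod]
      calc (∏ j, ‖χ (a j) (b j) n (x j)‖) * ‖K x‖
          ≤ (∏ j, (Set.Ioo (a j) (b j)).indicator (1 : ℝ → ℝ) (x j)) * ‖K x‖ :=
            mul_le_mul_of_nonneg_right
              (Finset.prod_le_prod (fun _ _ => norm_nonneg _) fun j _ => hle _ _ _ _)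
              (norm_nonneg _)
        _ = _ := by
            rw [prod_indicator_eq_indicator_pi]
            by_cases hx : x ∈ Set.univ.pi fun j => Set.Ioo (a j) (b j) <;> simp [Set.indicator, hx]
    · refine Filter.Eventually.of_forall fun x => ?_
      rw [← prod_indicator_eq_indicator_pi]
      exact (tendsto_finsetProd _ fun j _ => hlim _ _ _).mul_const _
  have h0 : ∀ n : ℕ, ∫ x, (∏ j, χ (a j) (b j) n (x j)) * K x = 0 := fun n =>
    h (fun j => χ (a j) (b j) n) (fun j => hd _ _ _) fun j => hc _ _ _
  simp only [h0] at hT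
  have h1 := tendsto_nhds_unique hT tendsto_const_nhds
  rw [← integral_indicator hmeas, ← h1]
  refine integral_congr_ae (Filter.Eventually.of_forall fun x => ?_)
  by_cases hx : x ∈ Set.univ.pi fun j => Set.Ioo (a j) (b j) <;> simp [Set.indicator, hx]

/-- A locally integrable function orthogonal to all tensor products of test functions vanishes. -/
theorem ae_eq_zero_of_integral_prod_test_mul_eq_zero {K : (Fin s → ℝ) → ℝ}
    (hK : LocallyIntegrable K)
    (h : ∀ χ : Fin s → ℝ → ℝ, (∀ j, ContDiff ℝ ∞ (χ j)) → (∀ j, HasCompactSupport (χ j)) →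
      ∫ x, (∏ j, χ j (x j)) * K x = 0) : K =ᵐ[volume] 0 := by
  let B : ℕ → Set (Fin s → ℝ) := fun n => Set.univ.pi fun _ => Set.Ioo (-(n : ℝ)) n
  have hB : ∀ n, MeasurableSet (B n) := fun n => MeasurableSet.univ_pi fun j => measurableSet_Ioo
  have hmain : ∀ n, ∀ᵐ x : Fin s → ℝ, x ∈ B n → K x = 0 := fun n => by
    have hKb : IntegrableOn K (B n) :=
      (hK.integrableOn_isCompact
        (isCompact_univ_pi fun j => isCompact_Icc (a := -(n : ℝ)) (b := n))).mono_set
        (Set.pi_mono fun j _ => Set.Ioo_subset_Icc_self)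
    rw [← ae_restrict_iff' (hB n)]
    -- On the bounded box `B n`, `K` is the density of a finite signed measure. Rational boxes form
    -- a generating π-system, and intersecting one with `B n` gives a box again, where the integral
    -- is known to vanish.
    refine Integrable.ae_eq_of_withDensityᵥ_eq hKb (integrable_zero _ _ _) ?_
    have hgen : ∀ S ∈ Set.univ.pi '' Set.univ.pi (fun _ : Fin s =>
        ⋃ (a : ℚ) (b : ℚ) (_ : a < b), {Set.Ioo (a : ℝ) (b : ℝ)}),
        (volume.restrict (B n)).withDensityᵥ K S = (volume.restrict (B n)).withDensityᵥ 0 S := by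
      rintro _ ⟨A, hA, rfl⟩
      simp only [Set.mem_pi, Set.mem_univ, true_imp_iff, Set.mem_iUnion,
        Set.mem_singleton_iff] at hA
      choose a b hab hAab using hA
      have hAm : MeasurableSet (Set.univ.pi A) := MeasurableSet.univ_pi fun j => by
        rw [hAab j]; exact measurableSet_Ioo
      rw [withDensityᵥ_apply hKb hAm, withDensityᵥ_apply (integrable_zero _ _ _) hAm,
        Measure.restrict_restrict hAm]
      have : Set.univ.pi A ∩ B n =
          Set.univ.pi fun j => Set.Ioo (max (a j : ℝ) (-n)) (min (b j : ℝ) n) := by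
        rw [← Set.pi_inter_distrib]
        refine Set.pi_congr rfl fun j _ => ?_
        rw [hAab j, Set.Ioo_inter_Ioo]
      rw [this, setIntegral_box_eq_zero hK h]
      simp
    refine VectorMeasure.ext_of_generateFrom _ hgen ?_ (IsPiSystem.pi fun _ =>
      Real.isPiSystem_Ioo_rat) ?_
    · exact (generateFrom_eq_pi (fun _ => Real.borel_eq_generateFrom_Ioo_rat.symm) fun _ =>
        (Real.finiteSpanningSetsInIooRat volume).isCountablySpanning).symm
    · rw [withDensityᵥ_apply hKb MeasurableSet.univ,
        withDensityᵥ_apply (integrable_zero _ _ _) MeasurableSet.univ, Measure.restrict_univ,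
        setIntegral_box_eq_zero hK h]
      simp
  filter_upwards [ae_all_iff.mpr hmain] with x hx
  obtain ⟨n, hn⟩ := exists_nat_gt (∑ j, |x j|)
  refine hx n fun j _ => ?_
  have : |x j| < n := lt_of_le_of_lt
    (Finset.single_le_sum (f := fun j => |x j|) (fun _ _ => abs_nonneg _) (Finset.mem_univ j)) hn
  exact abs_lt.mp this

end TestFunctions

/-! ### Weak partial derivatives and absolutely continuous slices -/

section Slices

variable {s : ℕ}

/-- The involution exchanging the `i`-th coordinate of `x` with `t`. -/
def updateSwap (i : Fin s) : (Fin s → ℝ) × ℝ ≃ᵐ (Fin s → ℝ) × ℝ where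
  toFun z := (update z.1 i z.2, z.1 i)
  invFun z := (update z.1 i z.2, z.1 i)
  left_inv z := by simp
  right_inv z := by simp
  measurable_toFun := measurable_update'.prodMk ((measurable_pi_apply i).comp measurable_fst)
  measurable_invFun := measurable_update'.prodMk ((measurable_pi_apply i).comp measurable_fst)

theorem measurePreserving_updateSwap (ν : Measure ℝ) [SigmaFinite ν] (i : Fin s) :
    MeasurePreserving (updateSwap i) ((Measure.pi fun _ : Fin s => ν).prod ν)
      ((Measure.pi fun _ : Fin s => ν).prod ν) :=
  measurePreserving_update_swap ν i

theorem volume_preserving_updateSwap (i : Fin s) :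
    MeasurePreserving (updateSwap i) (volume : Measure ((Fin s → ℝ) × ℝ)) volume :=
  measurePreserving_updateSwap volume i

theorem quasiMeasurePreserving_update (i : Fin s) :
    Measure.QuasiMeasurePreserving (fun z : (Fin s → ℝ) × ℝ => update z.1 i z.2) volume volume :=
  (Measure.quasiMeasurePreserving_fst (μ := (volume : Measure (Fin s → ℝ)))
    (ν := (volume : Measure ℝ))).comp (volume_preserving_updateSwap i).quasiMeasurePreserving

theorem integrable_mul_swap {u : (Fin s → ℝ) → ℝ} {ρ : ℝ → ℝ} (hu : Integrable u)
    (hρ : Integrable ρ) (i : Fin s) :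
    Integrable fun z : (Fin s → ℝ) × ℝ => u (update z.1 i z.2) * ρ (z.1 i) :=
  ((volume_preserving_updateSwap i).integrable_comp_emb (updateSwap i).measurableEmbedding).mpr
    (hu.mul_prod hρ)

theorem integral_mul_swap (u : (Fin s → ℝ) → ℝ) (ρ : ℝ → ℝ) (i : Fin s) :
    ∫ z : (Fin s → ℝ) × ℝ, u (update z.1 i z.2) * ρ (z.1 i) = (∫ x, u x) * ∫ t, ρ t := by
  rw [← integral_prod_mul]
  exact (volume_preserving_updateSwap i).integral_comp' (g := fun z => u z.1 * ρ z.2)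

/-- Lebesgue measure is infinite, so integrating over the discarded coordinate needs a weight `ρ` of
mass one. -/
theorem integral_eq_integral_mul_integral_update {u : (Fin s → ℝ) → ℝ} (hu : Integrable u)
    {ρ : ℝ → ℝ} (hρ : Integrable ρ) (hρ1 : ∫ t, ρ t = 1) (i : Fin s) :
    ∫ x, u x = ∫ x, ρ (x i) * ∫ t, u (update x i t) := by
  have h := integral_mul_swap u ρ i
  rw [hρ1, mul_one, Measure.volume_eq_prod, integral_prod _ (integrable_mul_swap hu hρ i)] at h
  rw [← h]
  refine integral_congr_ae (Filter.Eventually.of_forall fun x => ?_)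
  simp only
  rw [integral_mul_const, mul_comm]

theorem norm_update_le {x : Fin s → ℝ} {N : ℝ} (hx : ‖x‖ ≤ N) (i : Fin s) {r : ℝ} (hr : |r| ≤ N) :
    ‖update x i r‖ ≤ N := by
  have hN : 0 ≤ N := (norm_nonneg x).trans hx
  rw [pi_norm_le_iff_of_nonneg hN] at hx ⊢
  intro j
  by_cases hj : j = i
  · subst hj; simpa using hr
  · simpa [hj] using hx j

/-- The updated point forgets `z.1 i`, so a second cut-off in that coordinate is needed for
integrability. -/
theorem integrable_cutoff_update {g : (Fin s → ℝ) → ℝ} (hg : LocallyIntegrable g) (i : Fin s)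
    (N : ℝ) : Integrable fun z : (Fin s → ℝ) × ℝ =>
      (Metric.closedBall (0 : Fin s → ℝ) N).indicator g (update z.1 i z.2) *
        (Set.Icc (-N) N).indicator (fun _ => (1 : ℝ)) (z.1 i) := by
  refine integrable_mul_swap ?_ ?_ i
  · exact (hg.integrableOn_isCompact (isCompact_closedBall 0 N)).integrable_indicator
      Metric.isClosed_closedBall.measurableSet
  · exact (integrableOn_const (by simp)).integrable_indicator measurableSet_Icc

theorem cutoff_update_eq (g : (Fin s → ℝ) → ℝ) (i : Fin s) {N : ℝ} {x : Fin s → ℝ} (hx : ‖x‖ ≤ N)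
    {r : ℝ} (hr : |r| ≤ N) :
    (Metric.closedBall (0 : Fin s → ℝ) N).indicator g (update x i r) *
        (Set.Icc (-N) N).indicator (fun _ => (1 : ℝ)) (x i) = g (update x i r) := by
  rw [Set.indicator_of_mem, Set.indicator_of_mem, mul_one]
  · have := (norm_le_pi_norm x i).trans hx
    exact abs_le.mp this
  · simpa using norm_update_le hx i hr

theorem ae_locallyIntegrable_update {g : (Fin s → ℝ) → ℝ} (hg : LocallyIntegrable g) (i : Fin s) :
    ∀ᵐ x : Fin s → ℝ, LocallyIntegrable fun r => g (update x i r) := by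
  have h : ∀ n : ℕ, ∀ᵐ x : Fin s → ℝ, Integrable fun r =>
      (Metric.closedBall (0 : Fin s → ℝ) n).indicator g (update x i r) *
        (Set.Icc (-(n : ℝ)) n).indicator (fun _ => (1 : ℝ)) (x i) := fun n =>
    (integrable_cutoff_update hg i n).prod_right_ae
  filter_upwards [ae_all_iff.mpr h] with x hx
  rw [locallyIntegrable_iff]
  intro k hk
  obtain ⟨R, hR⟩ := hk.isBounded.subset_closedBall (0 : ℝ)
  obtain ⟨n, hn⟩ := exists_nat_ge (max ‖x‖ R)
  have hkm := hk.measurableSet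
  refine ((hx n).integrableOn (s := k)).congr_fun (fun r hr => ?_) hkm
  refine cutoff_update_eq g i ((le_max_left _ _).trans hn) ?_
  have := hR hr
  rw [Metric.mem_closedBall, dist_zero_right, Real.norm_eq_abs] at this
  exact this.trans ((le_max_right _ _).trans hn)

/-- Along almost every line in direction `i`, `f` is a primitive of `g`. -/
def HasSliceDeriv (i : Fin s) (f g : (Fin s → ℝ) → ℝ) : Prop :=
  ∀ᵐ z : (Fin s → ℝ) × ℝ, f (update z.1 i z.2) - f z.1 = ∫ r in z.1 i..z.2, g (update z.1 i r)

theorem HasSliceDeriv.ae_slice {i : Fin s} {f g : (Fin s → ℝ) → ℝ} (h : HasSliceDeriv i f g) :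
    ∀ᵐ x : Fin s → ℝ, ∀ᵐ t : ℝ, f (update x i t) = f x + ∫ r in x i..t, g (update x i r) := by
  filter_upwards [Measure.ae_ae_of_ae_prod h] with x hx
  filter_upwards [hx] with t ht
  rw [← ht]
  ring

theorem contDiff_slice {ψ : (Fin s → ℝ) → ℝ} (hψ : ContDiff ℝ ∞ ψ) (x : Fin s → ℝ) (i : Fin s) :
    ContDiff ℝ ∞ fun t => ψ (update x i t) :=
  hψ.comp (contDiff_update _ x i)

theorem hasCompactSupport_slice {ψ : (Fin s → ℝ) → ℝ} (hc : HasCompactSupport ψ) (x : Fin s → ℝ)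
    (i : Fin s) : HasCompactSupport fun t => ψ (update x i t) := by
  refine HasCompactSupport.intro (hc.isCompact.image (continuous_apply i)) fun t ht => ?_
  refine image_eq_zero_of_notMem_tsupport fun h => ht ⟨_, h, by simp⟩

theorem contDiff_partial {ψ : (Fin s → ℝ) → ℝ} (hψ : ContDiff ℝ ∞ ψ) (i : Fin s) :
    ContDiff ℝ ∞ fun x => fderiv ℝ ψ x (Pi.single i 1) :=
  (hψ.fderiv_right (m := ∞) (by simp)).clm_apply contDiff_const

theorem hasCompactSupport_partial {ψ : (Fin s → ℝ) → ℝ} (hc : HasCompactSupport ψ) (i : Fin s) :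
    HasCompactSupport fun x => fderiv ℝ ψ x (Pi.single i 1) :=
  hc.fderiv_apply (𝕜 := ℝ) _

/-- Integration by parts from absolute continuity on slices. -/
theorem HasSliceDeriv.integral_partial_mul {i : Fin s} {f g : (Fin s → ℝ) → ℝ}
    (h : HasSliceDeriv i f g) (hf : LocallyIntegrable f) (hg : LocallyIntegrable g)
    {ψ : (Fin s → ℝ) → ℝ} (hψ : ContDiff ℝ ∞ ψ) (hc : HasCompactSupport ψ) :
    ∫ x, fderiv ℝ ψ x (Pi.single i 1) * f x = -∫ x, ψ x * g x := by
  obtain ⟨ρ, hρ, hρc, hρ1⟩ := exists_test_integral_one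
  have hρi := hρ.continuous.integrable_of_hasCompactSupport hρc (μ := volume)
  -- Both sides become averages of integrals over lines in direction `i`. On almost every line `f`
  -- is the primitive of `g` with base point `x i` and value `f x` there, so the one-dimensional
  -- formula applies.
  rw [integral_eq_integral_mul_integral_update (integrable_test_mul hf
      (contDiff_partial hψ i).continuous (hasCompactSupport_partial hc i)) hρi hρ1 i,
    integral_eq_integral_mul_integral_update (integrable_test_mul hg hψ.continuous hc) hρi hρ1 i,
    ← integral_neg]
  refine integral_congr_ae ?_
  filter_upwards [h.ae_slice, ae_locallyIntegrable_update hg i] with x hx hgx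
  rw [← mul_neg]
  congr 1
  rw [← integral_deriv_mul_primitive hgx (x i) (f x) (contDiff_slice hψ x i)
    (hasCompactSupport_slice hc x i)]
  refine integral_congr_ae ?_
  filter_upwards [hx] with t ht
  rw [ht, (hasDerivAt_comp_update (hψ.differentiable (by simp)) x i t).deriv]

/-- This kernel writes `∫ r in 0..a` as an integral over the whole line with a jointly measurable
integrand, as Fubini requires when `a` varies. -/
theorem measurable_signed_indicator :
    Measurable fun z : ℝ × ℝ => (Set.Ioc 0 z.1).indicator (fun _ => (1 : ℝ)) z.2 -
      (Set.Ioc z.1 0).indicator (fun _ => (1 : ℝ)) z.2 := by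
  have h1 : MeasurableSet {z : ℝ × ℝ | 0 < z.2 ∧ z.2 ≤ z.1} :=
    (measurableSet_lt measurable_const measurable_snd).inter
      (measurableSet_le measurable_snd measurable_fst)
  have h2 : MeasurableSet {z : ℝ × ℝ | z.1 < z.2 ∧ z.2 ≤ 0} :=
    (measurableSet_lt measurable_fst measurable_snd).inter
      (measurableSet_le measurable_snd measurable_const)
  exact ((measurable_const (a := (1 : ℝ))).indicator h1).sub
    ((measurable_const (a := (1 : ℝ))).indicator h2)

theorem intervalIntegral_eq_integral_signed_indicator {g : ℝ → ℝ} {a : ℝ}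
    (hg : IntervalIntegrable g volume 0 a) :
    ∫ r in (0 : ℝ)..a, g r = ∫ r, ((Set.Ioc 0 a).indicator (fun _ => (1 : ℝ)) r -
      (Set.Ioc a 0).indicator (fun _ => (1 : ℝ)) r) * g r := by
  rw [intervalIntegral, ← integral_indicator measurableSet_Ioc,
    ← integral_indicator measurableSet_Ioc, ← integral_sub]
  · refine integral_congr_ae (Filter.Eventually.of_forall fun r => ?_)
    simp only [sub_mul]
    congr 1 <;> simp [Set.indicator]
  · exact hg.1.integrable_indicator measurableSet_Ioc
  · exact hg.2.integrable_indicator measurableSet_Ioc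

/-- Since `k` vanishes for `|r| > N`, both cut-offs can be inserted without changing the inner
integral, and Fubini applies. The lemma serves slice primitives (signed indicator kernel) and slice
averages (`k` depending on `r` alone). -/
theorem integrableOn_closedBall_integral_update {g : (Fin s → ℝ) → ℝ} (hg : LocallyIntegrable g)
    (i : Fin s) {N C : ℝ} {k : ℝ × ℝ → ℝ} (hk : Measurable k) (hkC : ∀ z, ‖k z‖ ≤ C)
    (hk0 : ∀ a r, |a| ≤ N → N < |r| → k (a, r) = 0) :
    IntegrableOn (fun x => ∫ r, k (x i, r) * g (update x i r)) (Metric.closedBall 0 N) := by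
  have hint : Integrable fun z : (Fin s → ℝ) × ℝ => k (z.1 i, z.2) *
      ((Metric.closedBall (0 : Fin s → ℝ) N).indicator g (update z.1 i z.2) *
        (Set.Icc (-N) N).indicator (fun _ => (1 : ℝ)) (z.1 i)) := by
    refine (integrable_cutoff_update hg i N).bdd_mul (c := C) ?_
      (Filter.Eventually.of_forall fun z => hkC _)
    exact (hk.comp (((measurable_pi_apply i).comp measurable_fst).prodMk
      measurable_snd)).aestronglyMeasurable
  refine (hint.integral_prod_left.integrableOn (s := Metric.closedBall 0 N)).congr_fun
    (fun x hx => ?_) Metric.isClosed_closedBall.measurableSet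
  refine integral_congr_ae (Filter.Eventually.of_forall fun r => ?_)
  have hx' : ‖x‖ ≤ N := by simpa using hx
  simp only
  by_cases hr : |r| ≤ N
  · rw [cutoff_update_eq g i hx' hr]
  · rw [hk0 _ _ ((norm_le_pi_norm x i).trans hx') (not_le.mp hr), zero_mul, zero_mul]

theorem locallyIntegrable_of_closedBall {f : (Fin s → ℝ) → ℝ} (R : ℝ)
    (h : ∀ N, R ≤ N → IntegrableOn f (Metric.closedBall 0 N)) : LocallyIntegrable f := by
  rw [locallyIntegrable_iff]
  intro k hk
  obtain ⟨R', hR⟩ := hk.isBounded.subset_closedBall (0 : Fin s → ℝ)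
  exact (h (max R R') (le_max_left _ _)).mono_set
    (hR.trans (Metric.closedBall_subset_closedBall (le_max_right _ _)))

theorem locallyIntegrable_slice_primitive {g : (Fin s → ℝ) → ℝ} (hg : LocallyIntegrable g)
    (i : Fin s) : LocallyIntegrable fun x => ∫ r in (0 : ℝ)..x i, g (update x i r) := by
  refine (locallyIntegrable_of_closedBall 0 fun N _ =>
    integrableOn_closedBall_integral_update hg i (C := 2) measurable_signed_indicator (fun z => ?_)
      fun a r ha hr => ?_).congr ?_
  · refine (norm_sub_le _ _).trans ?_
    have h : ∀ S : Set ℝ, ‖S.indicator (fun _ => (1 : ℝ)) z.2‖ ≤ 1 := fun S =>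
      (norm_indicator_le_norm_self _ _).trans (by simp)
    linarith [h (Set.Ioc 0 z.1), h (Set.Ioc z.1 0)]
  · have ha' := abs_le.mp ha
    simp only
    rw [Set.indicator_of_notMem, Set.indicator_of_notMem, sub_zero]
    · rintro ⟨h1, h2⟩
      exact absurd hr (not_lt.mpr (abs_le.mpr ⟨by linarith, by linarith⟩))
    · rintro ⟨h1, h2⟩
      exact absurd hr (not_lt.mpr (abs_le.mpr ⟨by linarith, by linarith⟩))
  · filter_upwards [ae_locallyIntegrable_update hg i] with x hx
    exact (intervalIntegral_eq_integral_signed_indicator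
      (intervalIntegrable_of_locallyIntegrable hx _ _)).symm

theorem hasSliceDeriv_slice_primitive {g : (Fin s → ℝ) → ℝ} (hg : LocallyIntegrable g)
    (i : Fin s) : HasSliceDeriv i (fun x => ∫ r in (0 : ℝ)..x i, g (update x i r)) g := by
  have h := Measure.quasiMeasurePreserving_fst (μ := (volume : Measure (Fin s → ℝ)))
    (ν := (volume : Measure ℝ)) |>.ae (ae_locallyIntegrable_update hg i)
  filter_upwards [h] with z hz
  simp only [update_self, update_idem]
  exact intervalIntegral.integral_interval_sub_left
    (intervalIntegrable_of_locallyIntegrable hz _ _)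
    (intervalIntegrable_of_locallyIntegrable hz _ _)

/-- Exchanging `x i` with `t` moves `θ` into slot `i` and separates the integral of `χ i`. -/
theorem integral_prod_test_mul_average {K : (Fin s → ℝ) → ℝ} (hK : LocallyIntegrable K)
    (i : Fin s) {θ : ℝ → ℝ} (hθ : ContDiff ℝ ∞ θ) (hθc : HasCompactSupport θ)
    {χ : Fin s → ℝ → ℝ} (hχ : ∀ j, ContDiff ℝ ∞ (χ j)) (hχc : ∀ j, HasCompactSupport (χ j)) :
    ∫ x, (∏ j, χ j (x j)) * ∫ t, θ t * K (update x i t) =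
      (∫ t, χ i t) * ∫ x, (∏ j, (update χ i θ) j (x j)) * K x := by
  have hu : Integrable fun x : Fin s → ℝ => (∏ j, (update χ i θ) j (x j)) * K x := by
    refine integrable_test_mul hK (continuous_prod_test fun j => ?_)
      (hasCompactSupport_prod_test fun j => ?_)
    · by_cases hj : j = i
      · subst hj; simpa using hθ.continuous
      · simpa [hj] using (hχ j).continuous
    · by_cases hj : j = i
      · subst hj; simpa using hθc
      · simpa [hj] using hχc j
  have hi := (hχ i).continuous.integrable_of_hasCompactSupport (hχc i) (μ := volume)
  have h := integral_mul_swap (fun x : Fin s → ℝ => (∏ j, (update χ i θ) j (x j)) * K x) (χ i) i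
  rw [Measure.volume_eq_prod, integral_prod _ (integrable_mul_swap hu hi i)] at h
  rw [mul_comm, ← h]
  refine integral_congr_ae (Filter.Eventually.of_forall fun x => ?_)
  simp only
  rw [← integral_const_mul]
  refine integral_congr_ae (Filter.Eventually.of_forall fun t => ?_)
  simp only
  rw [prod_update_eq, prod_test_eq i x]
  ring

/-- The function `χ i - (∫ χ i) θ` has mean zero, hence is the derivative of a test function. So
testing `K` with `χ` agrees with testing it with `(∫ χ i) θ` in slot `i`, which is the same as
testing the average with `χ`. -/
theorem ae_eq_average_of_integral_partial_eq_zero {K : (Fin s → ℝ) → ℝ} (hK : LocallyIntegrable K)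
    (i : Fin s)
    (h : ∀ χ : Fin s → ℝ → ℝ, (∀ j, ContDiff ℝ ∞ (χ j)) → (∀ j, HasCompactSupport (χ j)) →
      ∫ x, (∏ j, (update χ i (deriv (χ i))) j (x j)) * K x = 0)
    {θ : ℝ → ℝ} (hθ : ContDiff ℝ ∞ θ) (hθc : HasCompactSupport θ) (hθ1 : ∫ t, θ t = 1) :
    K =ᵐ[volume] fun x => ∫ t, θ t * K (update x i t) := by
  have hA : LocallyIntegrable fun x : Fin s → ℝ => ∫ t, θ t * K (update x i t) := by
    obtain ⟨N, -, hN⟩ := exists_support_subset_Ioo hθc 0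
    obtain ⟨C, hC⟩ := hθc.exists_bound_of_continuous hθ.continuous
    refine locallyIntegrable_of_closedBall N fun M hM => integrableOn_closedBall_integral_update hK
      i (k := fun z => θ z.2) (hθ.continuous.measurable.comp measurable_snd) (fun z => hC _)
      fun a r _ hr => ?_
    refine image_eq_zero_of_notMem_tsupport fun hmem => ?_
    have := abs_lt.mpr (hN hmem)
    linarith
  rw [← sub_ae_eq_zero]
  refine ae_eq_zero_of_integral_prod_test_mul_eq_zero (hK.sub hA) fun χ hχ hχc => ?_
  have hi := (hχ i).continuous.integrable_of_hasCompactSupport (hχc i) (μ := volume)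
  have hθi := hθ.continuous.integrable_of_hasCompactSupport hθc (μ := volume)
  obtain ⟨Ψ, hΨ, hΨc, hΨd⟩ := exists_compact_primitive
    (ψ := fun t => χ i t - (∫ y, χ i y) * θ t) ((hχ i).sub (contDiff_const.mul hθ))
    ((hχc i).sub (hθc.mul_left)) (by
      rw [integral_sub hi (hθi.const_mul _), integral_const_mul, hθ1]
      simp)
  have h0 := h (update χ i Ψ) (fun j => by
      by_cases hj : j = i
      · subst hj; simpa using hΨ
      · simpa [hj] using hχ j) (fun j => by
      by_cases hj : j = i
      · subst hj; simpa using hΨc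
      · simpa [hj] using hχc j)
  have hint : ∀ u : ℝ → ℝ, ContDiff ℝ ∞ u → HasCompactSupport u →
      Integrable fun x : Fin s → ℝ => (∏ j, (update χ i u) j (x j)) * K x := fun u hu huc => by
    refine integrable_test_mul hK (continuous_prod_test fun j => ?_)
      (hasCompactSupport_prod_test fun j => ?_)
    · by_cases hj : j = i
      · subst hj; simpa using hu.continuous
      · simpa [hj] using (hχ j).continuous
    · by_cases hj : j = i
      · subst hj; simpa using huc
      · simpa [hj] using hχc j
  have hχe : ∀ x : Fin s → ℝ, ∏ j, χ j (x j) = ∏ j, (update χ i (χ i)) j (x j) := fun x => by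
    rw [update_eq_self]
  have h2 : ∫ x : Fin s → ℝ, (∏ j, χ j (x j)) * K x
      - (∫ t, χ i t) * ((∏ j, (update χ i θ) j (x j)) * K x) = 0 := by
    rw [← h0]
    refine integral_congr_ae (Filter.Eventually.of_forall fun x => ?_)
    simp only [update_self, update_idem, hΨd]
    rw [hχe, prod_update_fun_eq, prod_update_fun_eq, prod_update_fun_eq]
    ring
  simp only [Pi.sub_apply, mul_sub]
  rw [integral_sub (integrable_test_mul hK (continuous_prod_test fun j => (hχ j).continuous)
      (hasCompactSupport_prod_test hχc)) (integrable_test_mul hA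
      (continuous_prod_test fun j => (hχ j).continuous) (hasCompactSupport_prod_test hχc)),
    integral_prod_test_mul_average hK i hθ hθc hχ hχc, ← integral_const_mul, ← integral_sub
      (integrable_test_mul hK (continuous_prod_test fun j => (hχ j).continuous)
      (hasCompactSupport_prod_test hχc)) ((hint θ hθ hθc).const_mul _)]
  exact h2

/-- A weak partial derivative, tested against tensor products, is a derivative on slices. -/
theorem hasSliceDeriv_of_integral_prod_test {f g : (Fin s → ℝ) → ℝ} (hf : LocallyIntegrable f)
    (hg : LocallyIntegrable g) (i : Fin s)
    (h : ∀ χ : Fin s → ℝ → ℝ, (∀ j, ContDiff ℝ ∞ (χ j)) → (∀ j, HasCompactSupport (χ j)) →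
      ∫ x, (∏ j, (update χ i (deriv (χ i))) j (x j)) * f x = -∫ x, (∏ j, χ j (x j)) * g x) :
    HasSliceDeriv i f g := by
  obtain ⟨θ, hθ, hθc, hθ1⟩ := exists_test_integral_one
  have hG := locallyIntegrable_slice_primitive hg i
  have hGs := hasSliceDeriv_slice_primitive hg i
  -- Both `f` and the slice primitive have weak derivative `g` in direction `i`, so their difference
  -- is its own average along that direction.
  have hK : (f - fun x => ∫ r in (0 : ℝ)..x i, g (update x i r)) =ᵐ[volume] _ :=
    ae_eq_average_of_integral_partial_eq_zero (hf.sub hG) i (fun χ hχ hχc => by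
    have h1 := hGs.integral_partial_mul hG hg (contDiff_prod_test hχ)
      (hasCompactSupport_prod_test hχc)
    simp only [fderiv_prod_test hχ] at h1
    have hd : ∀ j, ContDiff ℝ ∞ (update χ i (deriv (χ i)) j) := fun j => by
      by_cases hj : j = i
      · subst hj; simpa using (contDiff_infty_iff_deriv.mp (hχ j)).2
      · simpa [hj] using hχ j
    have hdc : ∀ j, HasCompactSupport (update χ i (deriv (χ i)) j) := fun j => by
      by_cases hj : j = i
      · subst hj; simpa using (hχc j).deriv
      · simpa [hj] using hχc j
    have hcont := continuous_prod_test fun j => (hd j).continuous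
    have hcs := hasCompactSupport_prod_test hdc
    simp only [Pi.sub_apply, mul_sub]
    rw [integral_sub (integrable_test_mul hf hcont hcs) (integrable_test_mul hG hcont hcs), h1,
      h χ hχ hχc, sub_self]) hθ hθc hθ1
  have h1 := (quasiMeasurePreserving_update i).ae hK
  have h2 := Measure.quasiMeasurePreserving_fst (μ := (volume : Measure (Fin s → ℝ)))
    (ν := (volume : Measure ℝ)) |>.ae hK
  filter_upwards [h1, h2, hGs] with z hz1 hz2 hz3
  -- The average does not see the `i`-th coordinate, so the difference takes the same value at `z.1`
  -- and at the updated point.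
  simp only [update_idem] at hz1
  rw [← hz2] at hz1
  simp only [Pi.sub_apply] at hz1
  rw [← hz3]
  linarith

end Slices

/-! ### The ANOVA projections -/

section Projections

variable {φ : ℝ → ℝ} {s : ℕ}

theorem productMeasure_update (hφ : IsPosDensity φ) (i : Fin s) :
    MeasurePreserving (fun z : (Fin s → ℝ) × ℝ => update z.1 i z.2)
      ((productMeasure φ s).prod (densityMeasure φ)) (productMeasure φ s) :=
  haveI := hφ.prob
  measurePreserving_update (densityMeasure φ) i

theorem productMeasure_update_update (hφ : IsPosDensity φ) (i j : Fin s) :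
    MeasurePreserving (fun z : (Fin s → ℝ) × ℝ × ℝ => update (update z.1 i z.2.1) j z.2.2)
      ((productMeasure φ s).prod ((densityMeasure φ).prod (densityMeasure φ)))
      (productMeasure φ s) := by
  have := hφ.prob
  have := hφ.product_prob s
  have h1 := (productMeasure_update hφ i).prod (MeasurePreserving.id (densityMeasure φ))
  have h2 := (measurePreserving_prodAssoc (productMeasure φ s) (densityMeasure φ)
    (densityMeasure φ)).symm
  exact (productMeasure_update hφ j).comp (h1.comp h2)

/-- Coordinate `j` is resampled while the second component, the endpoint of a slice in another
direction, is kept. -/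
theorem productMeasure_update_fst (hφ : IsPosDensity φ) (j : Fin s) :
    MeasurePreserving (fun z : ((Fin s → ℝ) × ℝ) × ℝ => (update z.1.1 j z.2, z.1.2))
      (((productMeasure φ s).prod (densityMeasure φ)).prod (densityMeasure φ))
      ((productMeasure φ s).prod (densityMeasure φ)) := by
  have := hφ.prob
  have := hφ.product_prob s
  have h1 := (productMeasure_update hφ j).prod (MeasurePreserving.id (densityMeasure φ))
  have h2 := measurePreserving_prodAssoc (productMeasure φ s) (densityMeasure φ)
    (densityMeasure φ)
  have h3 := (MeasurePreserving.id (productMeasure φ s)).prod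
    (Measure.measurePreserving_swap (μ := densityMeasure φ) (ν := densityMeasure φ))
  exact h1.comp (h2.symm.comp (h3.comp h2))

theorem hasSliceDeriv_iff (hφ : IsPosDensity φ) (i : Fin s) (f g : (Fin s → ℝ) → ℝ) :
    HasSliceDeriv i f g ↔ ∀ᵐ z ∂((productMeasure φ s).prod (densityMeasure φ)),
      f (update z.1 i z.2) - f z.1 = ∫ r in z.1 i..z.2, g (update z.1 i r) := by
  have := hφ.prob
  have := hφ.product_prob s
  exact ⟨fun h => (Measure.AbsolutelyContinuous.prod (hφ.product_ac_volume s)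
    (IsPosDensity.ac_volume φ)) h,
    fun h => (Measure.AbsolutelyContinuous.prod (hφ.volume_ac_product s) hφ.volume_ac) h⟩

theorem integrable_comp_update (hφ : IsPosDensity φ) {f : (Fin s → ℝ) → ℝ}
    (hf : Integrable f (productMeasure φ s)) (i : Fin s) :
    Integrable (fun z : (Fin s → ℝ) × ℝ => f (update z.1 i z.2))
      ((productMeasure φ s).prod (densityMeasure φ)) :=
  (productMeasure_update hφ i).integrable_comp_of_integrable hf

theorem ae_integrable_update (hφ : IsPosDensity φ) {f : (Fin s → ℝ) → ℝ}
    (hf : Integrable f (productMeasure φ s)) (i : Fin s) :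
    ∀ᵐ x ∂(productMeasure φ s), Integrable (fun t => f (update x i t)) (densityMeasure φ) :=
  haveI := hφ.prob
  haveI := hφ.product_prob s
  (integrable_comp_update hφ hf i).prod_right_ae

theorem integrable_anovaProj (hφ : IsPosDensity φ) {f : (Fin s → ℝ) → ℝ}
    (hf : Integrable f (productMeasure φ s)) (i : Fin s) :
    Integrable (anovaProj φ i f) (productMeasure φ s) :=
  haveI := hφ.prob
  haveI := hφ.product_prob s
  (integrable_comp_update hφ hf i).integral_prod_left

theorem integral_eq_integral_anovaProj (hφ : IsPosDensity φ) {f : (Fin s → ℝ) → ℝ}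
    (hf : Integrable f (productMeasure φ s)) (i : Fin s) :
    ∫ x, f x ∂(productMeasure φ s) = ∫ x, anovaProj φ i f x ∂(productMeasure φ s) := by
  have := hφ.prob
  have := hφ.product_prob s
  have h := productMeasure_update hφ i
  have h1 : ∫ x, f x ∂(productMeasure φ s) = ∫ z, f (update z.1 i z.2)
      ∂((productMeasure φ s).prod (densityMeasure φ)) := by
    conv_lhs => rw [← h.map_eq]
    exact integral_map h.measurable.aemeasurable (by rw [h.map_eq]; exact hf.aestronglyMeasurable)
  rw [h1, integral_prod _ (integrable_comp_update hφ hf i)]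
  rfl

theorem anovaProj_congr_ae (hφ : IsPosDensity φ) {f g : (Fin s → ℝ) → ℝ}
    (h : f =ᵐ[productMeasure φ s] g) (i : Fin s) :
    anovaProj φ i f =ᵐ[productMeasure φ s] anovaProj φ i g := by
  have := hφ.prob
  filter_upwards [Measure.ae_ae_of_ae_prod ((productMeasure_update hφ i).quasiMeasurePreserving.ae h)]
    with x hx
  exact integral_congr_ae hx

theorem anovaProj_update (i : Fin s) (f : (Fin s → ℝ) → ℝ) (x : Fin s → ℝ) (t : ℝ) :
    anovaProj φ i f (update x i t) = anovaProj φ i f x := by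
  simp [anovaProj]

theorem anovaProj_sub (hφ : IsPosDensity φ) {f g : (Fin s → ℝ) → ℝ}
    (hf : Integrable f (productMeasure φ s)) (hg : Integrable g (productMeasure φ s)) (i : Fin s) :
    anovaProj φ i (f - g) =ᵐ[productMeasure φ s] anovaProj φ i f - anovaProj φ i g := by
  filter_upwards [ae_integrable_update hφ hf i, ae_integrable_update hφ hg i] with x h1 h2
  exact integral_sub h1 h2

theorem anovaProj_comm (hφ : IsPosDensity φ) {f : (Fin s → ℝ) → ℝ}
    (hf : Integrable f (productMeasure φ s)) {i j : Fin s} (hij : i ≠ j) :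
    anovaProj φ i (anovaProj φ j f) =ᵐ[productMeasure φ s]
      anovaProj φ j (anovaProj φ i f) := by
  have := hφ.prob
  have := hφ.product_prob s
  have h := (productMeasure_update_update hφ i j).integrable_comp_of_integrable hf
  filter_upwards [h.prod_right_ae] with x hx
  simp only [anovaProj]
  rw [integral_integral_swap hx]
  simp_rw [update_comm hij]

/-! ### `L^q` bounds for the projections, and slice derivatives under `P_j` -/

theorem rpow_abs_integral_le {X : Type*} [MeasurableSpace X] {m : Measure X}
    [IsProbabilityMeasure m] {q : ℝ} (hq : 1 ≤ q) {h : X → ℝ} (hi : Integrable h m)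
    (hqi : Integrable (fun x => |h x| ^ q) m) : |∫ x, h x ∂m| ^ q ≤ ∫ x, |h x| ^ q ∂m :=
  (Real.rpow_le_rpow (abs_nonneg _) abs_integral_le_integral_abs (by linarith)).trans
    ((convexOn_rpow hq).map_integral_le
      (continuousOn_id.rpow_const fun _ _ => Or.inr (by linarith)) isClosed_Ici
      (Filter.Eventually.of_forall fun x => abs_nonneg (h x)) hi.abs hqi)

theorem memLp_ofReal_iff {X : Type*} [MeasurableSpace X] {m : Measure X} {q : ℝ} (hq : 1 < q)
    {f : X → ℝ} : MemLp f (ENNReal.ofReal q) m ↔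
      AEStronglyMeasurable f m ∧ Integrable (fun x => |f x| ^ q) m := by
  have h0 : ENNReal.ofReal q ≠ 0 := by simp; linarith
  constructor
  · intro h
    refine ⟨h.1, ?_⟩
    have := h.integrable_norm_rpow h0 ENNReal.ofReal_ne_top
    rwa [ENNReal.toReal_ofReal (by linarith)] at this
  · rintro ⟨h1, h2⟩
    rw [← integrable_norm_rpow_iff h1 h0 ENNReal.ofReal_ne_top,
      ENNReal.toReal_ofReal (by linarith)]
    exact h2

theorem integrable_of_memLp_ofReal {X : Type*} [MeasurableSpace X] {m : Measure X}
    [IsFiniteMeasure m] {q : ℝ} (hq : 1 < q) {f : X → ℝ} (hf : MemLp f (ENNReal.ofReal q) m) :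
    Integrable f m :=
  hf.integrable (by simpa using hq.le)

theorem ae_memLp_update (hφ : IsPosDensity φ) {q : ℝ} (hq : 1 < q) {f : (Fin s → ℝ) → ℝ}
    (hf : MemLp f (ENNReal.ofReal q) (productMeasure φ s)) (i : Fin s) :
    ∀ᵐ x ∂(productMeasure φ s),
      MemLp (fun t => f (update x i t)) (ENNReal.ofReal q) (densityMeasure φ) := by
  have := hφ.prob
  have h1 := (hf.1.comp_measurePreserving (productMeasure_update hφ i)).prodMk_left
  have h2 := ae_integrable_update hφ ((memLp_ofReal_iff hq).mp hf).2 i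
  filter_upwards [h1, h2] with x hx1 hx2
  exact (memLp_ofReal_iff hq).mpr ⟨hx1, hx2⟩

/-- Jensen on almost every slice, followed by Fubini. -/
theorem memLp_anovaProj (hφ : IsPosDensity φ) {q : ℝ} (hq : 1 < q) {f : (Fin s → ℝ) → ℝ}
    (hf : MemLp f (ENNReal.ofReal q) (productMeasure φ s)) (i : Fin s) :
    MemLp (anovaProj φ i f) (ENNReal.ofReal q) (productMeasure φ s) ∧
      ∫ x, |anovaProj φ i f x| ^ q ∂(productMeasure φ s) ≤ ∫ x, |f x| ^ q ∂(productMeasure φ s) := by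
  have := hφ.prob
  have := hφ.product_prob s
  have hqi := ((memLp_ofReal_iff hq).mp hf).2
  have hP := integrable_anovaProj hφ hqi i
  have hm := (integrable_anovaProj hφ (integrable_of_memLp_ofReal hq hf) i).aestronglyMeasurable
  have hle : ∀ᵐ x ∂(productMeasure φ s),
      |anovaProj φ i f x| ^ q ≤ anovaProj φ i (fun y => |f y| ^ q) x := by
    filter_upwards [ae_memLp_update hφ hq hf i] with x hx
    exact rpow_abs_integral_le hq.le (integrable_of_memLp_ofReal hq hx)
      ((memLp_ofReal_iff hq).mp hx).2
  have hint : Integrable (fun x => |anovaProj φ i f x| ^ q) (productMeasure φ s) := by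
    refine hP.mono' ((hm.norm.aemeasurable.pow_const q).aestronglyMeasurable) ?_
    filter_upwards [hle] with x hx
    rwa [Real.norm_of_nonneg (by positivity)]
  refine ⟨(memLp_ofReal_iff hq).mpr ⟨hm, hint⟩, ?_⟩
  rw [integral_eq_integral_anovaProj hφ hqi i]
  exact integral_mono_ae hint hP hle

theorem HasSliceDeriv.sub {i : Fin s} {f f' g g' : (Fin s → ℝ) → ℝ}
    (h : HasSliceDeriv i f g) (h' : HasSliceDeriv i f' g') (hg : LocallyIntegrable g)
    (hg' : LocallyIntegrable g') : HasSliceDeriv i (f - f') (g - g') := by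
  have hfst := Measure.quasiMeasurePreserving_fst (μ := (volume : Measure (Fin s → ℝ)))
    (ν := (volume : Measure ℝ))
  filter_upwards [h, h', hfst.ae (ae_locallyIntegrable_update hg i),
    hfst.ae (ae_locallyIntegrable_update hg' i)] with z h1 h2 h3 h4
  simp only [Pi.sub_apply]
  rw [intervalIntegral.integral_sub (intervalIntegrable_of_locallyIntegrable h3 _ _)
    (intervalIntegrable_of_locallyIntegrable h4 _ _), ← h1, ← h2]
  ring

theorem hasSliceDeriv_anovaProj_self (i : Fin s) (f : (Fin s → ℝ) → ℝ) :
    HasSliceDeriv i (anovaProj φ i f) 0 :=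
  Filter.Eventually.of_forall fun z => by simp [anovaProj_update]

theorem hasSliceDeriv_zero (i : Fin s) : HasSliceDeriv i (0 : (Fin s → ℝ) → ℝ) 0 :=
  Filter.Eventually.of_forall fun z => by simp

/-- The slice primitive uses Lebesgue measure and `P_j` uses `φ`; this justifies Fubini for the
mixed product. The inner integral of `|k|` is `φ`-integrable, hence Lebesgue integrable on compact
intervals. -/
theorem integrable_prod_restrict_of_integrable_prod (hφ : IsPosDensity φ) {k : ℝ × ℝ → ℝ}
    (hk : Integrable k ((densityMeasure φ).prod (densityMeasure φ))) (a b : ℝ) :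
    Integrable k (((volume : Measure ℝ).restrict (Set.uIoc a b)).prod (densityMeasure φ)) := by
  have := hφ.prob
  have hac : (volume : Measure ℝ).restrict (Set.uIoc a b) ≪ densityMeasure φ :=
    Measure.restrict_le_self.absolutelyContinuous.trans hφ.volume_ac
  rw [integrable_prod_iff (hk.1.mono_ac (hac.prod Measure.AbsolutelyContinuous.rfl))]
  refine ⟨hac hk.prod_right_ae, ?_⟩
  exact ((hφ.locallyIntegrable hk.norm.integral_prod_left).integrableOn_isCompact
    (isCompact_uIcc (a := a) (b := b))).mono_set Set.uIoc_subset_uIcc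

/-- Integrate the slice identity over an independent `j`-th coordinate and interchange the two
integrals; `i ≠ j` keeps the endpoints fixed. -/
theorem HasSliceDeriv.anovaProj (hφ : IsPosDensity φ) {i j : Fin s} (hij : i ≠ j)
    {f g : (Fin s → ℝ) → ℝ} (h : HasSliceDeriv i f g) (hf : Integrable f (productMeasure φ s))
    (hg : Integrable g (productMeasure φ s)) :
    HasSliceDeriv i (anovaProj φ j f) (anovaProj φ j g) := by
  have := hφ.prob
  have := hφ.product_prob s
  rw [hasSliceDeriv_iff hφ] at h ⊢
  have h1 := Measure.ae_ae_of_ae_prod ((productMeasure_update_fst hφ j).quasiMeasurePreserving.ae h)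
  have hfst := Measure.quasiMeasurePreserving_fst (μ := productMeasure φ s)
    (ν := densityMeasure φ)
  have h2 := hfst.ae (ae_integrable_update hφ hf j)
  have h3 := (productMeasure_update hφ i).quasiMeasurePreserving.ae (ae_integrable_update hφ hf j)
  have h4 := hfst.ae
    ((productMeasure_update_update hφ i j).integrable_comp_of_integrable hg).prod_right_ae
  filter_upwards [h1, h2, h3, h4] with z hz1 hz2 hz3 hz4
  have hsw := intervalIntegral_integral_swap (μ := densityMeasure φ)
    (f := fun r u => g (update (update z.1 i r) j u))
    (integrable_prod_restrict_of_integrable_prod hφ hz4 (z.1 i) z.2)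
  simp only [_root_.anovaProj]
  rw [hsw, ← integral_sub hz3 hz2]
  refine integral_congr_ae ?_
  filter_upwards [hz1] with u hu
  simp only [update_of_ne hij] at hu
  simp_rw [update_comm hij]
  exact hu

/-- The one-dimensional inequality holds on almost every line in direction `i`, where `P_i f` is the
mean of the slice; integrating over the lines gives the claim. -/
theorem HasSliceDeriv.poincare (hφ : IsPosDensity φ) {q : ℝ} (hq : 1 < q) {P : ℝ}
    (hP : PoincareIneq φ q P) {i : Fin s} {f g : (Fin s → ℝ) → ℝ} (h : HasSliceDeriv i f g)
    (hf : MemLp f (ENNReal.ofReal q) (productMeasure φ s))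
    (hg : MemLp g (ENNReal.ofReal q) (productMeasure φ s)) :
    ∫ x, |(f - _root_.anovaProj φ i f) x| ^ q ∂(productMeasure φ s) ≤
      P * ∫ x, |g x| ^ q ∂(productMeasure φ s) := by
  have := hφ.prob
  have := hφ.product_prob s
  have hgl := hφ.locallyIntegrable_product (integrable_of_memLp_ofReal hq hg)
  have hd := ((memLp_ofReal_iff hq).mp (hf.sub (memLp_anovaProj hφ hq hf i).1)).2
  have hgi := ((memLp_ofReal_iff hq).mp hg).2
  rw [integral_eq_integral_anovaProj hφ hd i, integral_eq_integral_anovaProj hφ hgi i,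
    ← integral_const_mul]
  refine integral_mono_ae (integrable_anovaProj hφ hd i)
    ((integrable_anovaProj hφ hgi i).const_mul P) ?_
  filter_upwards [ae_memLp_update hφ hq hf i, ae_memLp_update hφ hq hg i,
    hφ.product_ac_volume s (ae_locallyIntegrable_update hgl i),
    hφ.product_ac_volume s h.ae_slice] with x h1 h2 h3 h4
  have hw : HasWeakDerivLine (fun t => f (update x i t)) (fun t => g (update x i t)) :=
    (hasWeakDerivLine_primitive h3 (x i) (f x)).congr_ae (Filter.EventuallyEq.symm h4)
  have := hP _ _ hw h1 h2
  simpa [_root_.anovaProj] using this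

end Projections

/-! ### Families of mixed derivatives -/

section Chains

variable {φ : ℝ → ℝ} {q : ℝ} {s : ℕ}

/-- A family `v ↦ F v` of `L^q` functions in which `F (insert j v)` is the derivative of `F v`
in direction `j`. -/
structure MixChain (φ : ℝ → ℝ) (q : ℝ) {s : ℕ} (F : Finset (Fin s) → (Fin s → ℝ) → ℝ) : Prop where
  memLp : ∀ v, MemLp (F v) (ENNReal.ofReal q) (productMeasure φ s)
  slice : ∀ v j, j ∉ v → HasSliceDeriv j (F v) (F (insert j v))

namespace MixChain

variable {F : Finset (Fin s) → (Fin s → ℝ) → ℝ}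

theorem integrable (hφ : IsPosDensity φ) (hq : 1 < q) (hF : MixChain φ q F)
    (v : Finset (Fin s)) : Integrable (F v) (productMeasure φ s) :=
  haveI := hφ.product_prob s
  integrable_of_memLp_ofReal hq (hF.memLp v)

theorem locallyIntegrable (hφ : IsPosDensity φ) (hq : 1 < q) (hF : MixChain φ q F)
    (v : Finset (Fin s)) : LocallyIntegrable (F v) :=
  hφ.locallyIntegrable_product (hF.integrable hφ hq v)

theorem foldr_partial_contDiff (l : List (Fin s)) {ψ : (Fin s → ℝ) → ℝ} (hψ : ContDiff ℝ ∞ ψ)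
    (hc : HasCompactSupport ψ) :
    ContDiff ℝ ∞ (l.foldr (fun j g => fun x => fderiv ℝ g x (Pi.single j 1)) ψ) ∧
      HasCompactSupport (l.foldr (fun j g => fun x => fderiv ℝ g x (Pi.single j 1)) ψ) := by
  induction l with
  | nil => exact ⟨hψ, hc⟩
  | cons i l ih => exact ⟨contDiff_partial ih.1 i, hasCompactSupport_partial ih.2 i⟩

/-- Each integration by parts removes one derivative from `ψ`, adds its direction to the index of
`F`, and contributes a sign. -/
theorem integral_foldr_partial (hφ : IsPosDensity φ) (hq : 1 < q) (hF : MixChain φ q F)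
    (l : List (Fin s)) (hl : l.Nodup) (w : Finset (Fin s)) (hw : ∀ i ∈ l, i ∉ w)
    {ψ : (Fin s → ℝ) → ℝ} (hψ : ContDiff ℝ ∞ ψ) (hc : HasCompactSupport ψ) :
    ∫ x, l.foldr (fun j g => fun x => fderiv ℝ g x (Pi.single j 1)) ψ x * F w x =
      (-1) ^ l.length * ∫ x, ψ x * F (w ∪ l.toFinset) x := by
  induction l generalizing w with
  | nil => simp
  | cons i l ih =>
    rw [List.nodup_cons] at hl
    obtain ⟨hd, hs⟩ := foldr_partial_contDiff l hψ hc
    have hi : i ∉ w := hw i (by simp)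
    rw [List.foldr_cons, (hF.slice w i hi).integral_partial_mul (hF.locallyIntegrable hφ hq _)
      (hF.locallyIntegrable hφ hq _) hd hs, ih hl.2 (insert i w) fun j hj => by
        rw [Finset.mem_insert, not_or]
        exact ⟨fun h => hl.1 (h ▸ hj), hw j (List.mem_cons_of_mem _ hj)⟩]
    have : insert i w ∪ l.toFinset = w ∪ (i :: l).toFinset := by
      ext; simp
    rw [this, List.length_cons, pow_succ]
    ring

theorem hasWeakMixedDeriv (hφ : IsPosDensity φ) (hq : 1 < q) (hF : MixChain φ q F)
    (v : Finset (Fin s)) : HasWeakMixedDeriv v (F ∅) (F v) := by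
  refine ⟨hF.locallyIntegrable hφ hq _, hF.locallyIntegrable hφ hq _, fun ψ hψ hc => ?_⟩
  have := hF.integral_foldr_partial hφ hq (v.sort (· ≤ ·)) (Finset.sort_nodup _ _) ∅
    (by simp) hψ hc
  simpa [mixedPartial] using this

theorem memWMix (hφ : IsPosDensity φ) (hq : 1 < q) (hF : MixChain φ q F) : MemWMix φ q (F ∅) :=
  fun v => ⟨F v, hF.hasWeakMixedDeriv hφ hq v, hF.memLp v⟩

end MixChain

theorem HasWeakMixedDeriv.ae_unique {v : Finset (Fin s)} {f g g' : (Fin s → ℝ) → ℝ}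
    (h : HasWeakMixedDeriv v f g) (h' : HasWeakMixedDeriv v f g') : g =ᵐ[volume] g' := by
  refine ae_eq_of_integral_contDiff_smul_eq h.2.1 h'.2.1 fun ψ hψ hc => ?_
  have := (h.2.2 ψ hψ hc).symm.trans (h'.2.2 ψ hψ hc)
  simpa using this

theorem HasWeakMixedDeriv.weakMixedDeriv_ae_eq {v : Finset (Fin s)} {f g : (Fin s → ℝ) → ℝ}
    (h : HasWeakMixedDeriv v f g) : weakMixedDeriv v f =ᵐ[volume] g := by
  have hex : ∃ g, HasWeakMixedDeriv v f g := ⟨g, h⟩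
  rw [weakMixedDeriv, dif_pos hex]
  exact hex.choose_spec.ae_unique h

theorem hasWeakMixedDeriv_empty {f : (Fin s → ℝ) → ℝ} (hf : LocallyIntegrable f) :
    HasWeakMixedDeriv ∅ f f :=
  ⟨hf, hf, fun ψ _ _ => by simp [mixedPartial]⟩

theorem mixChain_of_hasWeakMixedDeriv {f : (Fin s → ℝ) → ℝ}
    {F : Finset (Fin s) → (Fin s → ℝ) → ℝ} (h : ∀ v, HasWeakMixedDeriv v f (F v))
    (hq : ∀ v, MemLp (F v) (ENNReal.ofReal q) (productMeasure φ s)) : MixChain φ q F := by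
  refine ⟨hq, fun v j hj => hasSliceDeriv_of_integral_prod_test (h v).2.1 (h _).2.1 j
    fun χ hχ hχc => ?_⟩
  have hd : ∀ k, ContDiff ℝ ∞ (update χ j (deriv (χ j)) k) := fun k => by
    by_cases hk : k = j
    · subst hk; simpa using (contDiff_infty_iff_deriv.mp (hχ k)).2
    · simpa [hk] using hχ k
  have hdc : ∀ k, HasCompactSupport (update χ j (deriv (χ j)) k) := fun k => by
    by_cases hk : k = j
    · subst hk; simpa using (hχc k).deriv
    · simpa [hk] using hχc k
  -- Putting `deriv (χ j)` into slot `j` and then applying `∂^v` gives the same function as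
  -- `∂^(insert j v)` of the original product, so the two weak identities share their left-hand
  -- side.
  have h1 := (h v).2.2 _ (contDiff_prod_test hd) (hasCompactSupport_prod_test hdc)
  have h2 := (h (insert j v)).2.2 _ (contDiff_prod_test hχ) (hasCompactSupport_prod_test hχc)
  rw [mixedPartial_prod_test v hd] at h1
  rw [mixedPartial_prod_test _ hχ, Finset.card_insert_of_notMem hj, pow_succ] at h2
  have h3 : (fun x : Fin s → ℝ => ∏ k, (if k ∈ v then deriv (update χ j (deriv (χ j)) k)
      else update χ j (deriv (χ j)) k) (x k)) =
      fun x => ∏ k, (if k ∈ insert j v then deriv (χ k) else χ k) (x k) := by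
    funext x
    refine Finset.prod_congr rfl fun k _ => ?_
    by_cases hk : k = j
    · subst hk; simp [hj]
    · simp [hk]
  rw [h3, h2] at h1
  simp only [smul_eq_mul, mul_assoc] at h1
  have := mul_left_cancel₀ (pow_ne_zero _ (by norm_num : (-1 : ℝ) ≠ 0)) h1
  rw [← this]
  ring

/-- The norm is defined through chosen versions of the derivatives; almost everywhere uniqueness
replaces them by the chain. -/
theorem MixChain.mixNorm_eq (hφ : IsPosDensity φ) (hq : 1 < q)
    {F : Finset (Fin s) → (Fin s → ℝ) → ℝ} (hF : MixChain φ q F) :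
    mixNorm φ q (F ∅) = (∑ v, ∫ x, |F v x| ^ q ∂(productMeasure φ s)) ^ (1 / q) := by
  unfold mixNorm
  congr 1
  refine Finset.sum_congr rfl fun v _ => integral_congr_ae ?_
  filter_upwards [hφ.product_ac_volume s (hF.hasWeakMixedDeriv hφ hq v).weakMixedDeriv_ae_eq]
    with x hx
  rw [hx]

/-- The action of `P_i` on a family of mixed derivatives. -/
noncomputable def chainProj (φ : ℝ → ℝ) (i : Fin s) (F : Finset (Fin s) → (Fin s → ℝ) → ℝ) :
    Finset (Fin s) → (Fin s → ℝ) → ℝ :=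
  fun u => if i ∈ u then 0 else anovaProj φ i (F u)

/-- The action of `I - P_i` on a family of mixed derivatives. -/
noncomputable def chainSub (φ : ℝ → ℝ) (i : Fin s) (F : Finset (Fin s) → (Fin s → ℝ) → ℝ) :
    Finset (Fin s) → (Fin s → ℝ) → ℝ :=
  fun u => if i ∈ u then F u else F u - anovaProj φ i (F u)

variable {F : Finset (Fin s) → (Fin s → ℝ) → ℝ}

theorem MixChain.chainProj (hφ : IsPosDensity φ) (hq : 1 < q) (hF : MixChain φ q F) (i : Fin s) :
    MixChain φ q (chainProj φ i F) := by
  refine ⟨fun u => ?_, fun v j hj => ?_⟩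
  · unfold _root_.chainProj
    split_ifs
    · exact MemLp.zero
    · exact (memLp_anovaProj hφ hq (hF.memLp u) i).1
  · unfold _root_.chainProj
    by_cases hji : j = i
    · subst hji
      simp only [hj, if_false, Finset.mem_insert_self, if_true]
      exact hasSliceDeriv_anovaProj_self j _
    · by_cases hi : i ∈ v
      · simp only [hi, if_true, Finset.mem_insert_of_mem]
        exact hasSliceDeriv_zero j
      · have hi' : i ∉ insert j v := by simp [hi, Ne.symm hji]
        simp only [hi, hi', if_false]
        exact (hF.slice v j hj).anovaProj hφ hji (hF.integrable hφ hq _) (hF.integrable hφ hq _)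

theorem MixChain.chainSub (hφ : IsPosDensity φ) (hq : 1 < q) (hF : MixChain φ q F) (i : Fin s) :
    MixChain φ q (chainSub φ i F) := by
  refine ⟨fun u => ?_, fun v j hj => ?_⟩
  · unfold _root_.chainSub
    split_ifs
    · exact hF.memLp u
    · exact (hF.memLp u).sub (memLp_anovaProj hφ hq (hF.memLp u) i).1
  · unfold _root_.chainSub
    by_cases hi : i ∈ v
    · simp only [hi, if_true, Finset.mem_insert_of_mem]
      exact hF.slice v j hj
    · by_cases hji : j = i
      · subst hji
        simp only [hj, if_false, Finset.mem_insert_self, if_true]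
        simpa using (hF.slice v j hj).sub (hasSliceDeriv_anovaProj_self (φ := φ) j (F v))
          (hF.locallyIntegrable hφ hq _) locallyIntegrable_zero
      · have hi' : i ∉ insert j v := by simp [hi, Ne.symm hji]
        simp only [hi, hi', if_false]
        exact (hF.slice v j hj).sub
          ((hF.slice v j hj).anovaProj hφ hji (hF.integrable hφ hq _) (hF.integrable hφ hq _))
          (hF.locallyIntegrable hφ hq _)
          (hφ.locallyIntegrable_product (integrable_anovaProj hφ (hF.integrable hφ hq _) i))

/-- A derivative in a projected direction is zero; otherwise every projection is a contraction. -/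
theorem MixChain.foldr_chainProj (hφ : IsPosDensity φ) (hq : 1 < q) (hF : MixChain φ q F)
    (l : List (Fin s)) :
    MixChain φ q (l.foldr (_root_.chainProj φ) F) ∧
      (l.foldr (_root_.chainProj φ) F) ∅ = l.foldr (fun j g => anovaProj φ j g) (F ∅) ∧
      ∀ u, ∫ x, |(l.foldr (_root_.chainProj φ) F) u x| ^ q ∂(productMeasure φ s) ≤
        if ∃ i ∈ l, i ∈ u then 0 else ∫ x, |F u x| ^ q ∂(productMeasure φ s) := by
  have hq0 : q ≠ 0 := by linarith
  induction l with
  | nil => exact ⟨hF, rfl, fun u => by simp⟩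
  | cons i l ih =>
    obtain ⟨h1, h2, h3⟩ := ih
    refine ⟨h1.chainProj hφ hq i, ?_, fun u => ?_⟩
    · rw [List.foldr_cons, List.foldr_cons, ← h2]
      simp [_root_.chainProj]
    · rw [List.foldr_cons]
      by_cases hi : i ∈ u
      · rw [if_pos ⟨i, by simp, hi⟩]
        simp [_root_.chainProj, hi, Real.zero_rpow hq0]
      · have h4 := (memLp_anovaProj hφ hq (h1.memLp u) i).2.trans (h3 u)
        simp only [List.mem_cons, exists_eq_or_imp, hi, false_or]
        simpa [_root_.chainProj, hi] using h4

theorem MixChain.foldr_chainSub (hφ : IsPosDensity φ) (hq : 1 < q) (hF : MixChain φ q F)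
    (l : List (Fin s)) :
    MixChain φ q (l.foldr (_root_.chainSub φ) F) ∧
      (l.foldr (_root_.chainSub φ) F) ∅ = l.foldr (fun j g => g - anovaProj φ j g) (F ∅) := by
  induction l with
  | nil => exact ⟨hF, rfl⟩
  | cons i l ih =>
    obtain ⟨h1, h2⟩ := ih
    refine ⟨h1.chainSub hφ hq i, ?_⟩
    rw [List.foldr_cons, List.foldr_cons, ← h2]
    simp [_root_.chainSub]

/-- A direction already in `u` is left untouched by `I - P_i`. Every other one costs one Poincaré
inequality, which replaces `u` by `insert i u`. -/
theorem MixChain.integral_foldr_chainSub_le (hφ : IsPosDensity φ) (hq : 1 < q)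
    (hF : MixChain φ q F) {P : ℝ} (hP0 : 0 < P) (hP : PoincareIneq φ q P) (l : List (Fin s))
    (u : Finset (Fin s)) :
    ∫ x, |(l.foldr (_root_.chainSub φ) F) u x| ^ q ∂(productMeasure φ s) ≤
      P ^ (l.toFinset \ u).card * ∫ x, |F (u ∪ l.toFinset) x| ^ q ∂(productMeasure φ s) := by
  induction l generalizing u with
  | nil => simp
  | cons i l ih =>
    obtain ⟨h1, -⟩ := hF.foldr_chainSub hφ hq l
    rw [List.foldr_cons]
    by_cases hi : i ∈ u
    · have e1 : (i :: l).toFinset \ u = l.toFinset \ u := by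
        rw [List.toFinset_cons, Finset.insert_sdiff_of_mem _ hi]
      have e2 : u ∪ (i :: l).toFinset = u ∪ l.toFinset := by
        ext j
        simp only [List.toFinset_cons, Finset.mem_union, Finset.mem_insert]
        constructor
        · rintro (h | rfl | h)
          exacts [Or.inl h, Or.inl hi, Or.inr h]
        · rintro (h | h)
          exacts [Or.inl h, Or.inr (Or.inr h)]
      rw [e1, e2]
      simpa [_root_.chainSub, hi] using ih u
    · have h2 := (h1.slice u i hi).poincare hφ hq hP (h1.memLp u) (h1.memLp _)
      have h3 := h2.trans (mul_le_mul_of_nonneg_left (ih (insert i u)) hP0.le)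
      have e1 : (i :: l).toFinset \ u = insert i (l.toFinset \ insert i u) := by
        ext j
        by_cases hj : j = i
        · subst hj; simp [hi]
        · simp [hj]
      have e2 : u ∪ (i :: l).toFinset = insert i u ∪ l.toFinset := by
        ext j; simp
      rw [e1, e2, Finset.card_insert_of_notMem (by simp), pow_succ', mul_assoc]
      simpa [_root_.chainSub, hi] using h3

/-- The family of mixed derivatives of the ANOVA term `f_v`. -/
noncomputable def chainAnova (φ : ℝ → ℝ) (v : Finset (Fin s)) (F : Finset (Fin s) → (Fin s → ℝ) → ℝ) :
    Finset (Fin s) → (Fin s → ℝ) → ℝ :=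
  (v.sort (· ≤ ·)).foldr (_root_.chainSub φ) ((vᶜ.sort (· ≤ ·)).foldr (_root_.chainProj φ) F)

theorem MixChain.chainAnova (hφ : IsPosDensity φ) (hq : 1 < q) (hF : MixChain φ q F)
    (v : Finset (Fin s)) : MixChain φ q (chainAnova φ v F) ∧
      _root_.chainAnova φ v F ∅ = anovaTerm φ v (F ∅) := by
  obtain ⟨h1, h2, -⟩ := hF.foldr_chainProj hφ hq (vᶜ.sort (· ≤ ·))
  obtain ⟨h3, h4⟩ := h1.foldr_chainSub hφ hq (v.sort (· ≤ ·))
  refine ⟨h3, ?_⟩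
  rw [_root_.chainAnova, h4, h2]
  rfl

theorem MixChain.integral_chainAnova_le (hφ : IsPosDensity φ) (hq : 1 < q) (hF : MixChain φ q F)
    {P : ℝ} (hP0 : 0 < P) (hP : PoincareIneq φ q P) (v u : Finset (Fin s)) :
    ∫ x, |_root_.chainAnova φ v F u x| ^ q ∂(productMeasure φ s) ≤
      if u ⊆ v then P ^ (v \ u).card * ∫ x, |F v x| ^ q ∂(productMeasure φ s) else 0 := by
  obtain ⟨h1, -, h3⟩ := hF.foldr_chainProj hφ hq (vᶜ.sort (· ≤ ·))
  have h4 := h1.integral_foldr_chainSub_le hφ hq hP0 hP (v.sort (· ≤ ·)) u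
  rw [Finset.sort_toFinset] at h4
  refine h4.trans ?_
  have h5 := h3 (u ∪ v)
  split_ifs with huv
  · rw [if_neg (by simp [Finset.union_eq_right.mpr huv]),
      Finset.union_eq_right.mpr huv] at h5
    rw [Finset.union_eq_right.mpr huv]
    exact mul_le_mul_of_nonneg_left h5 (by positivity)
  · obtain ⟨i, hi, hiv⟩ := Finset.not_subset.mp huv
    rw [if_pos ⟨i, by simpa using hiv, by simp [hi]⟩] at h5
    exact mul_nonpos_of_nonneg_of_nonpos (by positivity) h5

theorem MixChain.mixNorm_anovaTerm_le (hφ : IsPosDensity φ) (hq : 1 < q) (hF : MixChain φ q F)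
    {P : ℝ} (hP0 : 0 < P) (hP : PoincareIneq φ q P) (v : Finset (Fin s)) :
    mixNorm φ q (anovaTerm φ v (F ∅)) ≤
      ((P + 1) ^ v.card * ∫ x, |F v x| ^ q ∂(productMeasure φ s)) ^ (1 / q) := by
  obtain ⟨h1, h2⟩ := hF.chainAnova hφ hq v
  rw [← h2, h1.mixNorm_eq hφ hq]
  refine Real.rpow_le_rpow (Finset.sum_nonneg fun u _ => integral_nonneg fun x => by positivity)
    ((Finset.sum_le_sum fun u _ => hF.integral_chainAnova_le hφ hq hP0 hP v u).trans ?_)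
    (by have : 0 < q := by linarith
        positivity)
  rw [← Finset.sum_filter, ← Finset.sum_mul]
  refine le_of_eq ?_
  congr 1
  have : Finset.univ.filter (fun u : Finset (Fin s) => u ⊆ v) = v.powerset := by
    ext; simp
  -- Binomial formula: the sum of `P ^ |v \ u|` over `u ⊆ v` is `(1 + P) ^ |v|`.
  rw [this, add_comm P 1, ← Finset.sum_pow_mul_eq_add_pow]
  refine Finset.sum_congr rfl fun u hu => ?_
  rw [one_pow, one_mul, Finset.card_sdiff_of_subset (Finset.mem_powerset.mp hu)]

end Chains

/-! ### The ANOVA terms determine the function -/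

section Decomposition

variable {φ : ℝ → ℝ} {q : ℝ} {s : ℕ}

/-- `I - P_j` for `j ∈ v` and `P_j` otherwise. -/
noncomputable def anovaFactor (φ : ℝ → ℝ) (v : Finset (Fin s)) (j : Fin s)
    (g : (Fin s → ℝ) → ℝ) : (Fin s → ℝ) → ℝ :=
  if j ∈ v then g - anovaProj φ j g else anovaProj φ j g

theorem integrable_anovaFactor (hφ : IsPosDensity φ) (v : Finset (Fin s)) (j : Fin s)
    {g : (Fin s → ℝ) → ℝ} (hg : Integrable g (productMeasure φ s)) :
    Integrable (anovaFactor φ v j g) (productMeasure φ s) := by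
  unfold anovaFactor
  split_ifs
  · exact hg.sub (integrable_anovaProj hφ hg j)
  · exact integrable_anovaProj hφ hg j

theorem anovaFactor_congr_ae (hφ : IsPosDensity φ) (v : Finset (Fin s)) (j : Fin s)
    {g g' : (Fin s → ℝ) → ℝ} (h : g =ᵐ[productMeasure φ s] g') :
    anovaFactor φ v j g =ᵐ[productMeasure φ s] anovaFactor φ v j g' := by
  unfold anovaFactor
  split_ifs
  · exact h.sub (anovaProj_congr_ae hφ h j)
  · exact anovaProj_congr_ae hφ h j

theorem anovaFactor_comm (hφ : IsPosDensity φ) (v : Finset (Fin s)) (i j : Fin s)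
    {g : (Fin s → ℝ) → ℝ} (hg : Integrable g (productMeasure φ s)) :
    anovaFactor φ v i (anovaFactor φ v j g) =ᵐ[productMeasure φ s]
      anovaFactor φ v j (anovaFactor φ v i g) := by
  by_cases hij : i = j
  · subst hij; rfl
  have h1 := anovaProj_comm hφ hg hij
  have h2 := anovaProj_sub hφ hg (integrable_anovaProj hφ hg j) i
  have h3 := anovaProj_sub hφ hg (integrable_anovaProj hφ hg i) j
  unfold anovaFactor
  split_ifs <;> filter_upwards [h1, h2, h3] with x hx1 hx2 hx3 <;>
    simp only [Pi.sub_apply] at hx1 hx2 hx3 ⊢ <;> linarith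

theorem integrable_foldr_anovaFactor (hφ : IsPosDensity φ) (v : Finset (Fin s))
    (l : List (Fin s)) {f : (Fin s → ℝ) → ℝ} (hf : Integrable f (productMeasure φ s)) :
    Integrable (l.foldr (anovaFactor φ v) f) (productMeasure φ s) := by
  induction l with
  | nil => exact hf
  | cons i l ih => exact integrable_anovaFactor hφ v i ih

theorem foldr_anovaFactor_perm (hφ : IsPosDensity φ) (v : Finset (Fin s))
    {l l' : List (Fin s)} (h : l.Perm l') {f : (Fin s → ℝ) → ℝ}
    (hf : Integrable f (productMeasure φ s)) :
    l.foldr (anovaFactor φ v) f =ᵐ[productMeasure φ s] l'.foldr (anovaFactor φ v) f := by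
  induction h with
  | nil => rfl
  | cons i _ ih => exact anovaFactor_congr_ae hφ v i ih
  | swap i j l => exact anovaFactor_comm hφ v j i (integrable_foldr_anovaFactor hφ v l hf)
  | trans _ _ ih1 ih2 => exact ih1.trans ih2

/-- With one factor per coordinate, the terms for different `v` become comparable after reordering,
since the factors commute almost everywhere. -/
theorem anovaTerm_eq_foldr_anovaFactor (v : Finset (Fin s)) (f : (Fin s → ℝ) → ℝ) :
    anovaTerm φ v f =
      (v.sort (· ≤ ·) ++ vᶜ.sort (· ≤ ·)).foldr (anovaFactor φ v) f := by
  rw [List.foldr_append, anovaTerm, anovaProjSet]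
  have h1 : ∀ l : List (Fin s), (∀ j ∈ l, j ∉ v) →
      l.foldr (fun j g => anovaProj φ j g) f = l.foldr (anovaFactor φ v) f := fun l hl => by
    induction l with
    | nil => rfl
    | cons i l ih =>
      rw [List.foldr_cons, List.foldr_cons, ih fun j hj => hl j (List.mem_cons_of_mem _ hj),
        anovaFactor, if_neg (hl i (by simp))]
  have h2 : ∀ (l : List (Fin s)) (g : (Fin s → ℝ) → ℝ), (∀ j ∈ l, j ∈ v) →
      l.foldr (fun j g => g - anovaProj φ j g) g = l.foldr (anovaFactor φ v) g :=
    fun l g hl => by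
    induction l with
    | nil => rfl
    | cons i l ih =>
      rw [List.foldr_cons, List.foldr_cons, ih fun j hj => hl j (List.mem_cons_of_mem _ hj),
        anovaFactor, if_pos (hl i (by simp))]
  rw [h1 _ (by simp), h2 _ _ (by simp)]

theorem foldr_anovaFactor_congr (l : List (Fin s)) {v w : Finset (Fin s)}
    (h : ∀ j ∈ l, j ∈ v ↔ j ∈ w) (f : (Fin s → ℝ) → ℝ) :
    l.foldr (anovaFactor φ v) f = l.foldr (anovaFactor φ w) f := by
  induction l with
  | nil => rfl
  | cons i l ih =>
    rw [List.foldr_cons, List.foldr_cons, ih fun j hj => h j (List.mem_cons_of_mem _ hj),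
      anovaFactor, anovaFactor]
    simp only [h i (by simp)]

/-- The outermost coordinate is removed by adding the identities for `insert i v` and `v.erase i`:
`(g - P_i g) + P_i g = g`. -/
theorem ae_eq_zero_of_foldr_anovaFactor (l : List (Fin s)) (hl : l.Nodup)
    {f : (Fin s → ℝ) → ℝ}
    (h : ∀ v, l.foldr (anovaFactor φ v) f =ᵐ[productMeasure φ s] 0) :
    f =ᵐ[productMeasure φ s] 0 := by
  induction l with
  | nil => exact h ∅
  | cons i l ih =>
    rw [List.nodup_cons] at hl
    refine ih hl.2 fun v => ?_
    have h1 := h (insert i v)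
    have h2 := h (v.erase i)
    have hne : ∀ j ∈ l, j ≠ i := fun j hj hji => hl.1 (hji ▸ hj)
    rw [List.foldr_cons, foldr_anovaFactor_congr l (w := v) (fun j hj => by simp [hne j hj]),
      anovaFactor, if_pos (by simp)] at h1
    rw [List.foldr_cons, foldr_anovaFactor_congr l (w := v) (fun j hj => by simp [hne j hj]),
      anovaFactor, if_neg (by simp)] at h2
    filter_upwards [h1, h2] with x hx1 hx2
    simp only [Pi.sub_apply, Pi.zero_apply] at hx1 hx2 ⊢
    linarith

theorem ae_eq_zero_of_anovaTerm (hφ : IsPosDensity φ) {f : (Fin s → ℝ) → ℝ}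
    (hf : Integrable f (productMeasure φ s))
    (h : ∀ v, anovaTerm φ v f =ᵐ[productMeasure φ s] 0) : f =ᵐ[productMeasure φ s] 0 := by
  refine ae_eq_zero_of_foldr_anovaFactor _ (Finset.sort_nodup Finset.univ (· ≤ ·)) fun v => ?_
  refine (foldr_anovaFactor_perm hφ v ?_ hf).trans (anovaTerm_eq_foldr_anovaFactor v f ▸ h v)
  refine (List.perm_ext_iff_of_nodup (Finset.sort_nodup _ _) ?_).mpr fun j => ?_
  · refine List.Nodup.append (Finset.sort_nodup _ _) (Finset.sort_nodup _ _) fun j h1 h2 => ?_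
    simp at h1 h2
    exact h2 h1
  · simp [em]

theorem MixChain.anovaSupNorm_pos (hφ : IsPosDensity φ) (hq : 1 < q)
    {F : Finset (Fin s) → (Fin s → ℝ) → ℝ} (hF : MixChain φ q F)
    (h0 : ¬ F ∅ =ᵐ[volume] 0) : 0 < anovaSupNorm φ q (F ∅) := by
  have hq0 : q ≠ 0 := by linarith
  obtain ⟨v, hv⟩ : ∃ v, ¬ anovaTerm φ v (F ∅) =ᵐ[productMeasure φ s] 0 := by
    by_contra! hcon
    exact h0 (hφ.volume_ac_product s
      (ae_eq_zero_of_anovaTerm hφ (hF.integrable hφ hq ∅) hcon))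
  refine lt_of_lt_of_le ?_ (le_ciSup (f := fun v => mixNorm φ q (anovaTerm φ v (F ∅)))
    (Set.finite_range _).bddAbove v)
  obtain ⟨h1, h2⟩ := hF.chainAnova hφ hq v
  rw [← h2] at hv ⊢
  rw [h1.mixNorm_eq hφ hq]
  have hnn : ∀ u, 0 ≤ ∫ x, |_root_.chainAnova φ v F u x| ^ q ∂(productMeasure φ s) :=
    fun u => integral_nonneg fun x => by positivity
  -- The zeroth-order summand `u = ∅` is already positive for a nonzero term.
  refine Real.rpow_pos_of_pos (Finset.sum_pos' (fun u _ => hnn u) ⟨∅, Finset.mem_univ _, ?_⟩) _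
  refine lt_of_le_of_ne (hnn ∅) fun heq => hv ?_
  have := (integral_eq_zero_iff_of_nonneg (fun x => by positivity)
    ((memLp_ofReal_iff hq).mp (h1.memLp ∅)).2).mp heq.symm
  filter_upwards [this] with x hx
  simpa [Real.rpow_eq_zero (abs_nonneg _) hq0] using hx

end Decomposition

/-! ### A Poincaré inequality for densities with exponential decay -/

section Poincare

open scoped ENNReal

/-- Young's inequality `L^1 * L^q → L^q`: Hölder with `κ = κ ^ (1/q) * κ ^ (1/p)`, then Tonelli and
translation invariance. -/
theorem lintegral_rpow_convolution_le {q : ℝ} (hq : 1 < q) {γ κ : ℝ → ℝ≥0∞}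
    (hγ : AEMeasurable γ) (hκ : Measurable κ) :
    ∫⁻ x, (∫⁻ t, γ t * κ (x - t)) ^ q ≤ (∫⁻ y, κ y) ^ q * ∫⁻ t, γ t ^ q := by
  have hc := Real.HolderConjugate.conjExponent hq
  set p := q.conjExponent with hp
  have hq0 : 0 < q := by linarith
  have hp0 : 0 < p := hc.symm.pos
  have hpq : q / p + 1 = q := by
    have := hc.inv_add_inv_eq_one
    field_simp at this ⊢
    linarith
  have hκx : ∀ x : ℝ, Measurable fun t => κ (x - t) := fun x =>
    hκ.comp (measurable_const.sub measurable_id)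
  have hκi : ∀ x : ℝ, ∫⁻ t, κ (x - t) = ∫⁻ y, κ y := fun x =>
    lintegral_sub_left_eq_self κ x
  have h1 : ∀ x : ℝ, (∫⁻ t, γ t * κ (x - t)) ^ q ≤
      (∫⁻ y, κ y) ^ (q / p) * ∫⁻ t, γ t ^ q * κ (x - t) := fun x => by
    have hsplit : ∀ t, γ t * κ (x - t) =
        (fun t => γ t * κ (x - t) ^ (1 / q)) t * (fun t => κ (x - t) ^ (1 / p)) t := fun t => by
      simp only
      rw [mul_assoc, ← ENNReal.rpow_add_of_nonneg _ _ (by positivity) (by positivity)]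
      have : 1 / q + 1 / p = 1 := by simpa using hc.inv_add_inv_eq_one
      rw [this, ENNReal.rpow_one]
    have hH := ENNReal.lintegral_mul_le_Lp_mul_Lq volume hc
      (f := fun t => γ t * κ (x - t) ^ (1 / q)) (g := fun t => κ (x - t) ^ (1 / p))
      (hγ.mul ((hκx x).pow_const _).aemeasurable) ((hκx x).pow_const _).aemeasurable
    calc (∫⁻ t, γ t * κ (x - t)) ^ q
        ≤ ((∫⁻ t, (γ t * κ (x - t) ^ (1 / q)) ^ q) ^ (1 / q) *
            (∫⁻ t, (κ (x - t) ^ (1 / p)) ^ p) ^ (1 / p)) ^ q := by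
          refine ENNReal.rpow_le_rpow ?_ hq0.le
          rw [lintegral_congr hsplit]
          exact hH
      _ = _ := by
          rw [ENNReal.mul_rpow_of_nonneg _ _ hq0.le, ← ENNReal.rpow_mul, ← ENNReal.rpow_mul,
            one_div_mul_cancel hq0.ne', ENNReal.rpow_one, mul_comm]
          congr 1
          · rw [← hκi x]
            congr 1
            · refine lintegral_congr fun t => ?_
              rw [← ENNReal.rpow_mul, one_div_mul_cancel hp0.ne', ENNReal.rpow_one]
            · field_simp
          · refine lintegral_congr fun t => ?_
            rw [ENNReal.mul_rpow_of_nonneg _ _ hq0.le, ← ENNReal.rpow_mul,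
              one_div_mul_cancel hq0.ne', ENNReal.rpow_one]
  have hmeas : AEMeasurable (fun z : ℝ × ℝ => γ z.2 ^ q * κ (z.1 - z.2))
      ((volume : Measure ℝ).prod volume) :=
    ((hγ.pow_const q).comp_quasiMeasurePreserving Measure.quasiMeasurePreserving_snd).mul
      (hκ.comp (measurable_fst.sub measurable_snd)).aemeasurable
  have hsum : (∫⁻ y, κ y) ^ q = (∫⁻ y, κ y) ^ (q / p) * ∫⁻ y, κ y := by
    conv_lhs => rw [← hpq]
    rw [ENNReal.rpow_add_of_nonneg _ _ (by positivity) zero_le_one, ENNReal.rpow_one]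
  have h2 : ∫⁻ x : ℝ, ∫⁻ t, γ t ^ q * κ (x - t) = (∫⁻ y, κ y) * ∫⁻ t, γ t ^ q := by
    rw [lintegral_lintegral_swap (f := fun x t => γ t ^ q * κ (x - t)) hmeas, mul_comm,
      ← lintegral_mul_const'' _ (hγ.pow_const q)]
    refine lintegral_congr fun t => ?_
    have hκt : Measurable fun x => κ (x - t) := hκ.comp (measurable_id.sub measurable_const)
    rw [lintegral_const_mul _ hκt, lintegral_sub_right_eq_self κ t]
  calc ∫⁻ x, (∫⁻ t, γ t * κ (x - t)) ^ q
      ≤ ∫⁻ x, (∫⁻ y, κ y) ^ (q / p) * ∫⁻ t, γ t ^ q * κ (x - t) := lintegral_mono h1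
    _ = (∫⁻ y, κ y) ^ (q / p) * ((∫⁻ y, κ y) * ∫⁻ t, γ t ^ q) := by
        rw [lintegral_const_mul'' _ hmeas.lintegral_prod_right', h2]
    _ = _ := by rw [hsum, mul_assoc]

theorem lintegral_densityMeasure {φ : ℝ → ℝ} (hφ : IsPosDensity φ) (u : ℝ → ℝ≥0∞) :
    ∫⁻ x, u x ∂(densityMeasure φ) = ∫⁻ x, ENNReal.ofReal (φ x) * u x :=
  lintegral_withDensity_eq_lintegral_mul_non_measurable _
    (by have := hφ.continuous; fun_prop) (by simp) _

/-- By `hdecay` the weight at `x` moves inside the integral, so the weighted primitive is at most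
the convolution of `|g| φ^(1/q)` with `κ`. -/
theorem eLpNorm_primitive_le {φ : ℝ → ℝ} (hφ : IsPosDensity φ) {q : ℝ} (hq : 1 < q)
    {κ : ℝ → ℝ} (hκ : Continuous κ) (hκ0 : ∀ y, 0 ≤ κ y) (hκi : Integrable κ)
    (hdecay : ∀ x t, t ∈ Set.uIoc 0 x → φ x ^ (1 / q) ≤ κ (x - t) * φ t ^ (1 / q))
    {g : ℝ → ℝ} (hg : LocallyIntegrable g) :
    eLpNorm (fun x => ∫ t in (0 : ℝ)..x, g t) (ENNReal.ofReal q) (densityMeasure φ) ≤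
      ENNReal.ofReal (∫ y, κ y) * eLpNorm g (ENNReal.ofReal q) (densityMeasure φ) := by
  have hq0 : 0 < q := by linarith
  have hne : ENNReal.ofReal q ≠ 0 := by simpa using hq0
  have hω : Measurable fun x => φ x ^ (1 / q) := hφ.continuous.measurable.pow_const _
  have hnorm : ∀ u : ℝ → ℝ, eLpNorm u (ENNReal.ofReal q) (densityMeasure φ) =
      (∫⁻ x, (‖u x‖ₑ * ENNReal.ofReal (φ x ^ (1 / q))) ^ q) ^ (1 / q) := fun u => by
    rw [eLpNorm_eq_lintegral_rpow_enorm_toReal hne ENNReal.ofReal_ne_top,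
      ENNReal.toReal_ofReal hq0.le, lintegral_densityMeasure hφ]
    congr 1
    refine lintegral_congr fun x => ?_
    rw [ENNReal.mul_rpow_of_nonneg _ _ hq0.le, ENNReal.ofReal_rpow_of_nonneg
      (Real.rpow_nonneg (hφ.pos x).le _) hq0.le, ← Real.rpow_mul (hφ.pos x).le,
      one_div_mul_cancel hq0.ne', Real.rpow_one, mul_comm]
  rw [hnorm, hnorm, ofReal_integral_eq_lintegral_ofReal hκi (Filter.Eventually.of_forall hκ0)]
  have hpt : ∀ x, ‖∫ t in (0 : ℝ)..x, g t‖ₑ * ENNReal.ofReal (φ x ^ (1 / q)) ≤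
      ∫⁻ t, (‖g t‖ₑ * ENNReal.ofReal (φ t ^ (1 / q))) * ENNReal.ofReal (κ (x - t)) := fun x => by
    have h1 : ‖∫ t in (0 : ℝ)..x, g t‖ₑ ≤ ∫⁻ t in Set.uIoc 0 x, ‖g t‖ₑ := by
      refine le_trans (le_of_eq ?_) (enorm_integral_le_lintegral_enorm _)
      rw [← ofReal_norm, intervalIntegral.norm_intervalIntegral_eq, ofReal_norm]
    calc ‖∫ t in (0 : ℝ)..x, g t‖ₑ * ENNReal.ofReal (φ x ^ (1 / q))
        ≤ (∫⁻ t in Set.uIoc 0 x, ‖g t‖ₑ) * ENNReal.ofReal (φ x ^ (1 / q)) := by gcongr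
      _ = ∫⁻ t in Set.uIoc 0 x, ‖g t‖ₑ * ENNReal.ofReal (φ x ^ (1 / q)) := by
          rw [lintegral_mul_const' _ _ ENNReal.ofReal_ne_top]
      _ ≤ ∫⁻ t in Set.uIoc 0 x,
            (‖g t‖ₑ * ENNReal.ofReal (φ t ^ (1 / q))) * ENNReal.ofReal (κ (x - t)) := by
          refine setLIntegral_mono' measurableSet_uIoc fun t ht => ?_
          rw [mul_assoc, ← ENNReal.ofReal_mul (Real.rpow_nonneg (hφ.pos t).le _), mul_comm (φ t ^ _)]
          gcongr
          exact hdecay x t ht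
      _ ≤ _ := setLIntegral_le_lintegral _ _
  have hγ : AEMeasurable fun t => ‖g t‖ₑ * ENNReal.ofReal (φ t ^ (1 / q)) :=
    hg.aestronglyMeasurable.enorm.mul hω.ennreal_ofReal.aemeasurable
  calc (∫⁻ x, (‖∫ t in (0 : ℝ)..x, g t‖ₑ * ENNReal.ofReal (φ x ^ (1 / q))) ^ q) ^ (1 / q)
      ≤ ((∫⁻ y, ENNReal.ofReal (κ y)) ^ q *
          ∫⁻ t, (‖g t‖ₑ * ENNReal.ofReal (φ t ^ (1 / q))) ^ q) ^ (1 / q) := by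
        refine ENNReal.rpow_le_rpow ((lintegral_mono fun x =>
          ENNReal.rpow_le_rpow (hpt x) hq0.le).trans
          (lintegral_rpow_convolution_le hq hγ hκ.measurable.ennreal_ofReal)) (by positivity)
    _ = _ := by
        rw [ENNReal.mul_rpow_of_nonneg _ _ (by positivity), ← ENNReal.rpow_mul,
          mul_one_div_cancel hq0.ne', ENNReal.rpow_one]

/-- The mean of `f - c` is bounded by its `L^p` norm on a probability space, whence the factor `2`.
-/
theorem eLpNorm_sub_mean_le {X : Type*} [MeasurableSpace X] {m : Measure X}
    [IsProbabilityMeasure m] {p : ℝ≥0∞} (hp : 1 ≤ p) {f : X → ℝ} (hf : MemLp f p m) (c : ℝ) :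
    eLpNorm (fun x => f x - ∫ y, f y ∂m) p m ≤ 2 * eLpNorm (fun x => f x - c) p m := by
  have hfi : Integrable f m := hf.integrable hp
  have hu : MemLp (fun x => f x - c) p m := hf.sub (memLp_const c)
  have he : (fun x => f x - ∫ y, f y ∂m) = (fun x => f x - c) - fun _ => ∫ y, (f y - c) ∂m := by
    funext x
    rw [Pi.sub_apply, integral_sub hfi (integrable_const c)]
    simp
  have hconst : eLpNorm (fun _ : X => ∫ y, (f y - c) ∂m) p m ≤ eLpNorm (fun x => f x - c) p m := by
    rw [eLpNorm_const _ (by positivity) (IsProbabilityMeasure.ne_zero m)]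
    simp only [measure_univ, ENNReal.one_rpow, mul_one]
    refine (enorm_integral_le_lintegral_enorm _).trans ?_
    rw [← eLpNorm_one_eq_lintegral_enorm]
    exact eLpNorm_le_eLpNorm_of_exponent_le hp hu.1
  rw [he, two_mul]
  exact (eLpNorm_sub_le hu.1 aestronglyMeasurable_const hp).trans (by gcongr)

theorem exists_poincareIneq {φ : ℝ → ℝ} (hφ : IsPosDensity φ) {q : ℝ} (hq : 1 < q)
    {κ : ℝ → ℝ} (hκ : Continuous κ) (hκ0 : ∀ y, 0 < κ y) (hκi : Integrable κ)
    (hdecay : ∀ x t, t ∈ Set.uIoc 0 x → φ x ^ (1 / q) ≤ κ (x - t) * φ t ^ (1 / q)) :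
    ∃ P : ℝ, 0 < P ∧ PoincareIneq φ q P := by
  have := hφ.prob
  have hq0 : 0 < q := by linarith
  have hne : ENNReal.ofReal q ≠ 0 := by simpa using hq0
  have h1q : 1 ≤ ENNReal.ofReal q := by simpa using hq.le
  have hS0 : 0 ≤ ∫ y, κ y := integral_nonneg fun y => (hκ0 y).le
  -- The estimate itself needs `2 ∫ κ`; the added `1` makes positivity immediate.
  refine ⟨(2 * (∫ y, κ y) + 1) ^ q, by positivity, fun f g hfg hf hg => ?_⟩
  obtain ⟨c, hc⟩ := hfg.exists_ae_eq_primitive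
  have hu : MemLp (fun x => f x - ∫ y, f y ∂(densityMeasure φ)) (ENNReal.ofReal q)
    (densityMeasure φ) := hf.sub (memLp_const _)
  have hle : eLpNorm (fun x => f x - ∫ y, f y ∂(densityMeasure φ)) (ENNReal.ofReal q)
      (densityMeasure φ) ≤ ENNReal.ofReal (2 * (∫ y, κ y) + 1) *
        eLpNorm g (ENNReal.ofReal q) (densityMeasure φ) := by
    refine (eLpNorm_sub_mean_le h1q hf c).trans ?_
    have hcongr : (fun x => f x - c) =ᵐ[densityMeasure φ] fun x => ∫ t in (0 : ℝ)..x, g t := by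
      filter_upwards [IsPosDensity.ac_volume φ hc] with x hx
      rw [hx]; ring
    rw [eLpNorm_congr_ae hcongr]
    refine (mul_le_mul_right (eLpNorm_primitive_le hφ hq hκ (fun y => (hκ0 y).le) hκi hdecay
      hfg.2.1) 2).trans ?_
    rw [← mul_assoc]
    gcongr
    rw [← ENNReal.ofReal_ofNat 2, ← ENNReal.ofReal_mul (by norm_num)]
    exact ENNReal.ofReal_le_ofReal (by linarith)
  rw [hu.eLpNorm_eq_integral_rpow_norm hne ENNReal.ofReal_ne_top,
    hg.eLpNorm_eq_integral_rpow_norm hne ENNReal.ofReal_ne_top, ENNReal.toReal_ofReal hq0.le,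
    ← ENNReal.ofReal_mul (by positivity), ENNReal.ofReal_le_ofReal_iff (by positivity)] at hle
  simp only [Real.norm_eq_abs] at hle
  have hI1 : 0 ≤ ∫ x, |f x - ∫ y, f y ∂(densityMeasure φ)| ^ q ∂(densityMeasure φ) :=
    integral_nonneg fun x => by positivity
  have hI2 : 0 ≤ ∫ x, |g x| ^ q ∂(densityMeasure φ) := integral_nonneg fun x => by positivity
  have h := Real.rpow_le_rpow (by positivity) hle hq0.le
  rwa [Real.mul_rpow (by positivity) (by positivity), Real.rpow_inv_rpow hI1 hq0.ne',
    Real.rpow_inv_rpow hI2 hq0.ne'] at h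

end Poincare

/-! ### The generalized Gaussian density -/

theorem continuous_abs_rpow {p : ℝ} (hp : 0 ≤ p) : Continuous fun x : ℝ => |x| ^ p :=
  continuous_abs.rpow_const fun _ => Or.inr hp

theorem integral_exp_neg_mul_abs_rpow {p b : ℝ} (hp : 0 < p) (hb : 0 < b) :
    ∫ x : ℝ, Real.exp (-b * |x| ^ p) = 2 * (b ^ (-1 / p) * Real.Gamma (1 / p + 1)) := by
  rw [← integral_exp_neg_mul_rpow hp hb]
  exact integral_comp_abs (f := fun x => Real.exp (-b * x ^ p))

theorem integrable_exp_neg_mul_abs_rpow {p b : ℝ} (hp : 0 < p) (hb : 0 < b) :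
    Integrable fun x : ℝ => Real.exp (-b * |x| ^ p) := by
  refine Integrable.of_integral_ne_zero ?_
  rw [integral_exp_neg_mul_abs_rpow hp hb]
  have : 0 < Real.Gamma (1 / p + 1) := Real.Gamma_pos_of_pos (by positivity)
  positivity

theorem betaDensity_const_pos {β : ℝ} (hβ : 0 < β) :
    0 < 2 * β ^ (1 / β) * Real.Gamma (1 + 1 / β) := by
  have : 0 < Real.Gamma (1 + 1 / β) := Real.Gamma_pos_of_pos (by positivity)
  positivity

theorem betaDensity_eq (β : ℝ) : betaDensity β = fun x =>
    1 / (2 * β ^ (1 / β) * Real.Gamma (1 + 1 / β)) * Real.exp (-(1 / β) * |x| ^ β) := by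
  funext x
  rw [betaDensity]
  congr 2
  ring

theorem isPosDensity_betaDensity {β : ℝ} (hβ : 0 < β) : IsPosDensity (betaDensity β) := by
  have hZ := betaDensity_const_pos hβ
  have hpos : ∀ x, 0 < betaDensity β x := fun x => by unfold betaDensity; positivity
  refine ⟨?_, hpos, ⟨?_⟩⟩
  · unfold betaDensity
    exact continuous_const.mul (((continuous_abs_rpow hβ.le).div_const _).neg.rexp)
  · rw [densityMeasure, withDensity_apply _ MeasurableSet.univ, Measure.restrict_univ,
      ← ofReal_integral_eq_lintegral_ofReal _ (Filter.Eventually.of_forall fun x => (hpos x).le),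
      ENNReal.ofReal_eq_one]
    · rw [betaDensity_eq, integral_const_mul,
        integral_exp_neg_mul_abs_rpow hβ (by positivity : 0 < 1 / β)]
      have h1 : (1 / β) ^ (-1 / β) = β ^ (1 / β) := by
        rw [one_div, neg_div, Real.rpow_neg (by positivity), Real.inv_rpow hβ.le, inv_inv, one_div]
      rw [h1, add_comm (1 / β) 1]
      rw [← mul_assoc 2, one_div_mul_cancel hZ.ne']
    · rw [betaDensity_eq]
      exact (integrable_exp_neg_mul_abs_rpow hβ (by positivity)).const_mul _

theorem exists_mul_rpow_le {τ β c : ℝ} (hτ : 0 < τ) (hτβ : τ < β) (hc : 0 < c) :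
    ∃ C : ℝ, ∀ y : ℝ, 0 ≤ y → c * y ^ τ ≤ C + y ^ β / (2 * β) := by
  have hβ : 0 < β := hτ.trans hτβ
  have hd : 0 < β - τ := sub_pos.mpr hτβ
  -- `R` is the positive point where `c * y ^ τ` and `y ^ β / (2 * β)` are equal; beyond it the
  -- higher power dominates.
  set R := (2 * β * c) ^ (1 / (β - τ)) with hR
  have hR0 : 0 < R := by positivity
  have hRp : R ^ (β - τ) = 2 * β * c := by
    rw [hR, ← Real.rpow_mul (by positivity), one_div_mul_cancel hd.ne', Real.rpow_one]
  refine ⟨c * R ^ τ, fun y hy => ?_⟩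
  rcases le_total y R with h | h
  · have h1 : c * y ^ τ ≤ c * R ^ τ := by gcongr
    have h2 : 0 ≤ y ^ β / (2 * β) := by positivity
    linarith
  · have hy0 : 0 < y := hR0.trans_le h
    have h1 : 2 * β * c ≤ y ^ (β - τ) := hRp ▸ Real.rpow_le_rpow hR0.le h hd.le
    have h2 : y ^ β = y ^ (β - τ) * y ^ τ := by
      rw [← Real.rpow_add hy0]; congr 1; ring
    have h3 : c * y ^ τ ≤ y ^ β / (2 * β) := by
      rw [h2, le_div_iff₀ (by positivity)]
      have : 0 ≤ y ^ τ := by positivity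
      nlinarith
    have h4 : 0 ≤ c * R ^ τ := by positivity
    linarith

theorem integrable_exp_abs_rpow_betaDensity {τ β c : ℝ} (hτ : 0 < τ) (hτβ : τ ≤ β) (hc : 0 < c)
    (h : β = τ → c * β < 1) :
    Integrable (fun x : ℝ => Real.exp (c * |x| ^ τ)) (densityMeasure (betaDensity β)) := by
  have hβ : 0 < β := hτ.trans_le hτβ
  have hφ := isPosDensity_betaDensity hβ
  have hcont := hφ.continuous
  rw [densityMeasure, integrable_withDensity_iff_integrable_smul' (by fun_prop) (by simp)]
  -- Some negative multiple of `|x| ^ β` survives in the exponent: by the smallness condition if `β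
  -- = τ`, and by absorbing `c |x| ^ τ` into half of `|x| ^ β / β` if `τ < β`.
  obtain ⟨C, b, hb, hle⟩ : ∃ C b : ℝ, 0 < b ∧
      ∀ x : ℝ, c * |x| ^ τ - |x| ^ β / β ≤ C - b * |x| ^ β := by
    rcases hτβ.eq_or_lt with heq | hlt
    · subst heq
      refine ⟨0, 1 / τ - c, ?_, fun x => le_of_eq (by ring)⟩
      rw [sub_pos, lt_div_iff₀ hτ]
      exact h rfl
    · obtain ⟨C, hC⟩ := exists_mul_rpow_le hτ hlt hc
      refine ⟨C, 1 / (2 * β), by positivity, fun x => ?_⟩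
      have h1 := hC |x| (abs_nonneg x)
      have h2 : |x| ^ β / β = 2 * (|x| ^ β / (2 * β)) := by field_simp
      have h3 : 1 / (2 * β) * |x| ^ β = |x| ^ β / (2 * β) := by ring
      linarith
  have hZ := betaDensity_const_pos hβ
  have hZ' : 0 ≤ 1 / (2 * β ^ (1 / β) * Real.Gamma (1 + 1 / β)) := by positivity
  refine ((integrable_exp_neg_mul_abs_rpow hβ hb).const_mul
    (1 / (2 * β ^ (1 / β) * Real.Gamma (1 + 1 / β)) * Real.exp C)).mono' ?_ ?_
  · refine Continuous.aestronglyMeasurable ?_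
    have h1 := continuous_abs_rpow hτ.le
    have : (fun x => (ENNReal.ofReal (betaDensity β x)).toReal) = betaDensity β :=
      funext fun x => ENNReal.toReal_ofReal (hφ.pos x).le
    simp only [smul_eq_mul, congrFun this]
    exact hcont.mul (continuous_const.mul h1).rexp
  · refine Filter.Eventually.of_forall fun x => ?_
    rw [ENNReal.toReal_ofReal (hφ.pos x).le, smul_eq_mul,
      Real.norm_of_nonneg (mul_nonneg (hφ.pos x).le (Real.exp_pos _).le), betaDensity]
    generalize 1 / (2 * β ^ (1 / β) * Real.Gamma (1 + 1 / β)) = Z at hZ' ⊢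
    rw [mul_assoc, mul_assoc, ← Real.exp_add, ← Real.exp_add]
    refine mul_le_mul_of_nonneg_left (Real.exp_le_exp.mpr ?_) hZ'
    have := hle x
    linarith

/-- The chord of `exp` between `0` and `A * u` gives a bound affine in `a`; then `1 + y ≤ exp y`.
The exponent is linear in `a`, so a product over coordinates depends only on the sum of the `α j`.
-/
theorem integral_exp_mul_le {X : Type*} [MeasurableSpace X] {m : Measure X}
    [IsProbabilityMeasure m] {u : X → ℝ} {A a : ℝ} (hA : 0 < A)
    (hi : Integrable (fun x => Real.exp (A * u x)) m) (hu : AEStronglyMeasurable u m)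
    (ha : 0 ≤ a) (haA : a ≤ A) :
    Integrable (fun x => Real.exp (a * u x)) m ∧
      ∫ x, Real.exp (a * u x) ∂m ≤
        Real.exp (a * (((∫ x, Real.exp (A * u x) ∂m) - 1) / A)) := by
  have hle : ∀ x, Real.exp (a * u x) ≤ (1 - a / A) + a / A * Real.exp (A * u x) := fun x => by
    have h0 : 0 ≤ a / A := by positivity
    have h1 : 0 ≤ 1 - a / A := by rw [sub_nonneg, div_le_one hA]; exact haA
    have := convexOn_exp.2 (Set.mem_univ 0) (Set.mem_univ (A * u x)) h1 h0 (by ring)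
    simp only [smul_eq_mul, mul_zero, zero_add, Real.exp_zero, mul_one] at this
    have he : a / A * (A * u x) = a * u x := by field_simp
    rwa [he] at this
  have hint : Integrable (fun x => (1 - a / A) + a / A * Real.exp (A * u x)) m :=
    (integrable_const _).add (hi.const_mul _)
  have hint' : Integrable (fun x => Real.exp (a * u x)) m := by
    refine hint.mono' (Real.continuous_exp.comp_aestronglyMeasurable (hu.const_mul a)) ?_
    refine Filter.Eventually.of_forall fun x => ?_
    rw [Real.norm_of_nonneg (Real.exp_pos _).le]
    exact hle x
  refine ⟨hint', (integral_mono hint' hint hle).trans ?_⟩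
  rw [integral_add (integrable_const _) (hi.const_mul _), integral_const_mul]
  simp only [integral_const, probReal_univ, smul_eq_mul, one_mul]
  refine le_trans (le_of_eq ?_) (Real.add_one_le_exp _)
  field_simp
  ring

/-- The derivative of `y ^ β / β` is at least `1` for `y ≥ 1`, and the summand `1` on the right pays
for the segment `[0, 1]`. -/
theorem abs_sub_le_of_mem_uIoc {β x t : ℝ} (hβ : 1 ≤ β) (ht : t ∈ Set.uIoc 0 x) :
    |t| ^ β / β + |x - t| ≤ 1 + |x| ^ β / β := by
  have hβ0 : 0 < β := by linarith
  have hab : |t| ≤ |x| ∧ |x - t| = |x| - |t| := by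
    rcases le_total 0 x with h | h
    · rw [Set.uIoc_of_le h] at ht
      rw [abs_of_nonneg h, abs_of_pos ht.1, abs_of_nonneg (by linarith [ht.2])]
      exact ⟨ht.2, rfl⟩
    · rw [Set.uIoc_of_ge h] at ht
      rw [abs_of_nonpos h, abs_of_nonpos ht.2, abs_of_nonpos (by linarith [ht.1])]
      exact ⟨by linarith [ht.1], by ring⟩
  rw [hab.2]
  have ha := abs_nonneg t
  have hb := abs_nonneg x
  generalize |t| = a at *
  generalize |x| = b at *
  have hle := hab.1
  rcases le_total b 1 with hb1 | hb1
  · have : a ^ β / β ≤ b ^ β / β := by gcongr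
    linarith
  suffices h : β * (b - a - 1) ≤ b ^ β - a ^ β by
    have h1 : a ^ β / β + (b - a - 1) ≤ b ^ β / β := by
      rw [← sub_nonneg] at h ⊢
      have : b ^ β / β - (a ^ β / β + (b - a - 1)) = (b ^ β - a ^ β - β * (b - a - 1)) / β := by
        field_simp
        ring
      rw [this]
      positivity
    linarith
  -- Bernoulli's inequality in place of the derivative: expand `b ^ β` at `1` if `a ≤ 1`, and at `a`
  -- otherwise.
  rcases le_total a 1 with ha1 | ha1
  · have h1 := one_add_mul_self_le_rpow_one_add (s := b - 1) (by linarith) hβ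
    rw [add_sub_cancel] at h1
    have h2 : a ^ β ≤ 1 := Real.rpow_le_one ha ha1 hβ0.le
    nlinarith
  · have ha0 : 0 < a := by linarith
    have h1 := one_add_mul_self_le_rpow_one_add (s := b / a - 1)
      (by have : 0 ≤ b / a := by positivity
          linarith) hβ
    rw [add_sub_cancel, Real.div_rpow hb ha, le_div_iff₀ (by positivity)] at h1
    have h2 : a ≤ a ^ β := by
      simpa using Real.rpow_le_rpow_of_exponent_le ha1 hβ
    have h3 : 0 ≤ b / a - 1 := by rw [sub_nonneg, le_div_iff₀ ha0]; linarith
    have h4 : β * (b / a - 1) * a ≤ β * (b / a - 1) * a ^ β :=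
      mul_le_mul_of_nonneg_left h2 (by positivity)
    have h5 : β * (b / a - 1) * a = β * (b - a) := by field_simp
    nlinarith

/-- The generalized Gaussian density with `β ≥ 1` satisfies a Poincaré inequality. -/
theorem exists_poincareIneq_betaDensity {β q : ℝ} (hβ : 1 ≤ β) (hq : 1 < q) :
    ∃ P : ℝ, 0 < P ∧ PoincareIneq (betaDensity β) q P := by
  have hβ0 : 0 < β := by linarith
  have hq0 : 0 < q := by linarith
  have hφ := isPosDensity_betaDensity hβ0
  have hexp : (fun y : ℝ => Real.exp ((1 - |y|) / q)) =
      fun y => Real.exp (1 / q) * Real.exp (-(1 / q) * |y| ^ (1 : ℝ)) := by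
    funext y
    rw [← Real.exp_add, Real.rpow_one]
    congr 1
    ring
  -- The kernel is the `q`-th root of the decay factor `exp (1 - |y|)`.
  refine exists_poincareIneq hφ hq (κ := fun y => Real.exp ((1 - |y|) / q)) (by fun_prop)
    (fun y => Real.exp_pos _) ?_ fun x t ht => ?_
  · rw [hexp]
    exact (integrable_exp_neg_mul_abs_rpow one_pos (by positivity)).const_mul _
  · have h1 : Real.exp ((1 - |x - t|) / q) = Real.exp (1 - |x - t|) ^ (1 / q) := by
      rw [← Real.exp_mul]
      congr 1
      ring
    rw [h1, ← Real.mul_rpow (Real.exp_pos _).le (hφ.pos t).le]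
    refine Real.rpow_le_rpow (hφ.pos x).le ?_ (by positivity)
    have hZ := betaDensity_const_pos hβ0
    rw [betaDensity, betaDensity, mul_left_comm, ← Real.exp_add]
    refine mul_le_mul_of_nonneg_left (Real.exp_le_exp.mpr ?_) (by positivity)
    have := abs_sub_le_of_mem_uIoc hβ ht
    linarith

/-! ### Functionals of the parametric family -/

section Parametric

variable {d : ℕ} {D : Set (EuclideanSpace ℝ (Fin d))}

theorem H10.gradNorm_le_norm (u : H10 D) : H10.gradNorm u ≤ ‖u‖ := by
  have h : ‖u‖ ^ 2 = ‖(u : L2Pair D).fst‖ ^ 2 + ‖(u : L2Pair D).snd‖ ^ 2 :=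
    WithLp.prod_norm_sq_eq_of_L2 (u : L2Pair D)
  refine abs_le_of_sq_le_sq' ?_ (norm_nonneg u) |>.2
  rw [h, H10.gradNorm]
  linarith [sq_nonneg ‖(u : L2Pair D).fst‖]

/-- Continuity for the full `H¹` norm lets `G` pass through vector-valued integrals; the sharper
gradient bound is kept because the hypothesis on `p` controls only the gradient. -/
theorem HMinusOne.exists_clm (G : HMinusOne D) :
    ∃ (L : H10 D →L[ℝ] ℝ) (M : ℝ), 0 ≤ M ∧ (∀ u, L u = G.pairing u) ∧
      ∀ u, |L u| ≤ M * H10.gradNorm u := by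
  obtain ⟨M, hM⟩ := G.2
  have hM' : ∀ u : H10 D, |G.1 u| ≤ |M| * H10.gradNorm u := fun u =>
    (hM u).trans (mul_le_mul_of_nonneg_right (le_abs_self M) (norm_nonneg _))
  exact ⟨G.1.mkContinuous |M| fun u => (hM' u).trans
    (mul_le_mul_of_nonneg_left (H10.gradNorm_le_norm u) (abs_nonneg _)), |M|, abs_nonneg M,
    fun u => rfl, hM'⟩

theorem HasWeakMixedDeriv.clm_comp {s : ℕ} {E : Type*} [NormedAddCommGroup E] [NormedSpace ℝ E]
    [CompleteSpace E] (L : E →L[ℝ] ℝ) {v : Finset (Fin s)} {f g : (Fin s → ℝ) → E}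
    (h : HasWeakMixedDeriv v f g) :
    HasWeakMixedDeriv v (fun x => L (f x)) (fun x => L (g x)) := by
  have hloc : ∀ u : (Fin s → ℝ) → E, LocallyIntegrable u → LocallyIntegrable fun x => L (u x) :=
    fun u hu => by
      rw [← locallyIntegrableOn_univ] at hu ⊢
      exact L.locallyIntegrableOn_comp hu
  refine ⟨hloc f h.1, hloc g h.2.1, fun ψ hψ hc => ?_⟩
  obtain ⟨hd, hdc⟩ := MixChain.foldr_partial_contDiff (v.sort (· ≤ ·)) hψ hc
  have h1 := L.integral_comp_comm
    (h.1.integrable_smul_left_of_hasCompactSupport hd.continuous hdc)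
  have h2 := L.integral_comp_comm
    (h.2.1.integrable_smul_left_of_hasCompactSupport hψ.continuous hc)
  simp only [map_smul] at h1 h2
  rw [h2, ← map_smul, ← h.2.2 ψ hψ hc]
  exact h1

theorem integral_exp_sum_le {φ : ℝ → ℝ} (hφ : IsPosDensity φ) {q τ A : ℝ} (hq : 0 < q)
    (hτ : 0 < τ) (hA : 0 < A)
    (hi : Integrable (fun x => Real.exp (q * A * |x| ^ τ)) (densityMeasure φ)) {α : ℕ → ℝ}
    (hα : ∀ j, 0 ≤ α j) (hαA : ∀ j, α j ≤ A) (hsum : Summable α) (s : ℕ) :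
    Integrable (fun x : Fin s → ℝ => Real.exp (∑ j : Fin s, α j * |x j| ^ τ) ^ q)
      (productMeasure φ s) ∧
    ∫ x : Fin s → ℝ, Real.exp (∑ j : Fin s, α j * |x j| ^ τ) ^ q ∂(productMeasure φ s) ≤
      Real.exp ((∑' j, α j) *
        (((∫ x, Real.exp (q * A * |x| ^ τ) ∂(densityMeasure φ)) - 1) / A)) := by
  have := hφ.prob
  have hprod : (fun x : Fin s → ℝ => Real.exp (∑ j : Fin s, α j * |x j| ^ τ) ^ q) =
      fun x => ∏ j : Fin s, Real.exp (α j * (q * |x j| ^ τ)) := by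
    funext x
    rw [← Real.exp_sum, ← Real.exp_mul, Finset.sum_mul]
    congr 1
    exact Finset.sum_congr rfl fun j _ => by ring
  have hAe : (fun x : ℝ => Real.exp (q * A * |x| ^ τ)) =
      fun x => Real.exp (A * (q * |x| ^ τ)) := by
    funext x; congr 1; ring
  rw [hAe] at hi ⊢
  have hc : Continuous fun x : ℝ => q * |x| ^ τ := continuous_const.mul (continuous_abs_rpow hτ.le)
  have h1 := fun j => integral_exp_mul_le hA hi hc.aestronglyMeasurable (hα j) (hαA j)
  have hm : 0 ≤ (∫ x, Real.exp (A * (q * |x| ^ τ)) ∂(densityMeasure φ)) - 1 := by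
    rw [sub_nonneg]
    -- The exponent is nonnegative, so the exponential moment is at least `1`. This sign allows the
    -- partial sum of `α` to be replaced by the full series.
    have := integral_mono (integrable_const (1 : ℝ)) hi fun x =>
      Real.one_le_exp (by positivity : 0 ≤ A * (q * |x| ^ τ))
    simpa using this
  rw [hprod]
  refine ⟨Integrable.fintype_prod (f := fun (j : Fin s) (t : ℝ) =>
    Real.exp (α j * (q * |t| ^ τ))) fun j => (h1 j).1, ?_⟩
  rw [productMeasure, integral_fintype_prod_eq_prod (fun (j : Fin s) (t : ℝ) =>
    Real.exp (α j * (q * |t| ^ τ)))]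
  refine (Finset.prod_le_prod (s := (Finset.univ : Finset (Fin s)))
    (fun j _ => integral_nonneg fun x => (Real.exp_pos _).le) fun j _ => (h1 j).2).trans ?_
  rw [← Real.exp_sum, ← Finset.sum_mul]
  refine Real.exp_le_exp.mpr (mul_le_mul_of_nonneg_right ?_ (by positivity))
  rw [Fin.sum_univ_eq_sum_range α s]
  exact hsum.sum_le_tsum _ fun j _ => hα j

theorem memLp_of_ae_le {φ : ℝ → ℝ} (hφ : IsPosDensity φ) {q : ℝ} (hq : 1 < q) {s : ℕ}
    {f w : (Fin s → ℝ) → ℝ} {B : ℝ} (hf : LocallyIntegrable f)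
    (hw0 : ∀ x, 0 ≤ w x) (hw : Integrable (fun x => w x ^ q) (productMeasure φ s)) (hB : 0 ≤ B)
    (hle : ∀ᵐ x, |f x| ≤ B * w x) :
    MemLp f (ENNReal.ofReal q) (productMeasure φ s) ∧
      ∫ x, |f x| ^ q ∂(productMeasure φ s) ≤ B ^ q * ∫ x, w x ^ q ∂(productMeasure φ s) := by
  have hfm : AEStronglyMeasurable f (productMeasure φ s) :=
    hf.aestronglyMeasurable.mono_ac (hφ.product_ac_volume s)
  have hle' : ∀ᵐ x ∂(productMeasure φ s), |f x| ^ q ≤ B ^ q * w x ^ q := by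
    filter_upwards [hφ.product_ac_volume s hle] with x hx
    rw [← Real.mul_rpow hB (hw0 x)]
    exact Real.rpow_le_rpow (abs_nonneg _) hx (by linarith)
  have hint : Integrable (fun x => |f x| ^ q) (productMeasure φ s) := by
    refine (hw.const_mul (B ^ q)).mono' (hfm.norm.aemeasurable.pow_const q).aestronglyMeasurable ?_
    filter_upwards [hle'] with x hx
    rwa [Real.norm_of_nonneg (by positivity)]
  refine ⟨(memLp_ofReal_iff hq).mpr ⟨hfm, hint⟩, ?_⟩
  rw [← integral_const_mul]
  exact integral_mono_ae hint (hw.const_mul _) hle'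

theorem MixedDerivBound.exists_mixChain {φ : ℝ → ℝ} (hφ : IsPosDensity φ) {K σ τ q M E : ℝ}
    {b α : ℕ → ℝ} (hq : 1 < q) (hb : ∀ j, 0 ≤ b j) {s : ℕ}
    (hw : Integrable (fun x : Fin s → ℝ => Real.exp (∑ j : Fin s, α j * |x j| ^ τ) ^ q)
      (productMeasure φ s))
    (hE : ∫ x : Fin s → ℝ, Real.exp (∑ j : Fin s, α j * |x j| ^ τ) ^ q ∂(productMeasure φ s) ≤ E)
    (L : H10 D →L[ℝ] ℝ) (hM : 0 ≤ M) (hL : ∀ u, |L u| ≤ M * H10.gradNorm u)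
    {p : (Fin s → ℝ) → H10 D} (hp : MixedDerivBound p K σ τ b α) :
    ∃ F : Finset (Fin s) → (Fin s → ℝ) → ℝ, MixChain φ q F ∧ F ∅ = (fun x => L (p x)) ∧
      ∀ v, ∫ x, |F v x| ^ q ∂(productMeasure φ s) ≤
        (M * |K| * ((v.card.factorial : ℝ) ^ σ * ∏ j ∈ v, b j)) ^ q * E := by
  choose dp hdp hbound using hp
  -- At `∅` the function itself is used: `dp ∅` agrees with `p` only almost everywhere, while the
  -- ANOVA terms are formed from `f` pointwise.
  let F : Finset (Fin s) → (Fin s → ℝ) → ℝ := fun v =>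
    if v = ∅ then fun x => L (p x) else fun x => L (dp v x)
  have hL0 := (hdp ∅).clm_comp L
  have hF : ∀ v, HasWeakMixedDeriv v (fun x => L (p x)) (F v) := fun v => by
    by_cases hv : v = ∅
    · subst hv
      simpa [F] using hasWeakMixedDeriv_empty hL0.1
    · simpa [F, hv] using (hdp v).clm_comp L
  have hFae : ∀ v, F v =ᵐ[volume] fun x => L (dp v x) := fun v =>
    (hF v).ae_unique ((hdp v).clm_comp L)
  have hX : ∀ v : Finset (Fin s), 0 ≤ (v.card.factorial : ℝ) ^ σ * ∏ j ∈ v, b j := fun v =>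
    mul_nonneg (Real.rpow_nonneg (by positivity) _) (Finset.prod_nonneg fun j _ => hb j)
  have hle : ∀ v, ∀ᵐ x : Fin s → ℝ, |F v x| ≤
      (M * |K| * ((v.card.factorial : ℝ) ^ σ * ∏ j ∈ v, b j)) *
        Real.exp (∑ j : Fin s, α j * |x j| ^ τ) := fun v => by
    filter_upwards [hFae v, hbound v] with x h1 h2
    rw [h1]
    calc |L (dp v x)| ≤ M * H10.gradNorm (dp v x) := hL _
      _ ≤ M * (|K| * ((v.card.factorial : ℝ) ^ σ * ∏ j ∈ v, b j) *
            Real.exp (∑ j : Fin s, α j * |x j| ^ τ)) := by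
          -- `K` may be negative, hence the passage to `|K|`.
          refine mul_le_mul_of_nonneg_left (h2.trans ?_) hM
          rw [mul_assoc K]
          gcongr
          · exact hX v
          · exact le_abs_self K
      _ = _ := by ring
  have hmem := fun v => memLp_of_ae_le hφ hq (hF v).2.1
    (w := fun x => Real.exp (∑ j : Fin s, α j * |x j| ^ τ)) (fun x => (Real.exp_pos _).le) hw
    (mul_nonneg (mul_nonneg hM (abs_nonneg K)) (hX v)) (hle v)
  refine ⟨F, mixChain_of_hasWeakMixedDeriv hF fun v => (hmem v).1, by simp [F], fun v =>
    (hmem v).2.trans (mul_le_mul_of_nonneg_left hE (Real.rpow_nonneg ?_ _))⟩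
  exact mul_nonneg (mul_nonneg hM (abs_nonneg K)) (hX v)

end Parametric

/-! ### The main theorem -/

theorem mainTheorem4 {d : ℕ} (D : Set (EuclideanSpace ℝ (Fin d)))
    (hDopen : IsOpen D) (hDbdd : Bornology.IsBounded D) (G : HMinusOne D)
    (β τ σ K q : ℝ) (b α : ℕ → ℝ)
    (hτ : 0 < τ) (hτβ : τ ≤ β) (hσ : 1 ≤ σ)
    (hb : ∀ j, 0 ≤ b j) (hα : ∀ j, 0 ≤ α j) (hαsum : Summable α)
    (hq : 1 < q) (hqα : β = τ → q * (β * ⨆ j, α j) < 1) :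
    (1 ≤ β → ∃ P : ℝ, 0 < P ∧ PoincareIneq (betaDensity β) q P) ∧
    ∃ C : ℝ, 0 < C ∧
      ∀ (s : ℕ) (p : (Fin s → ℝ) → H10 D), MixedDerivBound p K σ τ b α →
        ∀ f : (Fin s → ℝ) → ℝ, (∀ x, f x = G.pairing (p x)) →
          MemWMix (betaDensity β) q f ∧
          (∀ v : Finset (Fin s), MemWMix (betaDensity β) q (anovaTerm (betaDensity β) v f)) ∧
          (¬ f =ᵐ[volume] 0 → 0 < anovaSupNorm (betaDensity β) q f) ∧
          ∀ P : ℝ, 0 < P → PoincareIneq (betaDensity β) q P →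
            ∀ Γ : ℕ → ℝ, (∀ j, Γ j = (P + 1) ^ (1 / q) * b j) →
              (∀ j, 0 < b j → 0 < Γ j) ∧
              ∀ v : Finset (Fin s),
                mixNorm (betaDensity β) q (anovaTerm (betaDensity β) v f) ≤
                  C * (v.card.factorial : ℝ) ^ σ * ∏ j ∈ v, Γ j ∧
                (¬ f =ᵐ[volume] 0 →
                  anovaWeight (betaDensity β) q f v ≤
                    C / anovaSupNorm (betaDensity β) q f *
                      ((v.card.factorial : ℝ) ^ σ * ∏ j ∈ v, Γ j)) := by
  refine ⟨fun hβ => exists_poincareIneq_betaDensity hβ hq, ?_⟩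
  have hβ : 0 < β := hτ.trans_le hτβ
  have hq0 : 0 < q := by linarith
  have hφ := isPosDensity_betaDensity hβ
  have hbdd : BddAbove (Set.range α) :=
    ⟨∑' j, α j, by rintro _ ⟨j, rfl⟩; exact hαsum.le_tsum j fun i _ => hα i⟩
  have hsup0 : 0 ≤ ⨆ j, α j := (hα 0).trans (le_ciSup hbdd 0)
  -- A common bound for all `α j`. It must be strictly positive, even when `α = 0`, because the
  -- moment bound divides by `A`; if `β = τ` it must also stay below `1 / (q * β)`.
  obtain ⟨A, hA, hsupA, hAβ⟩ : ∃ A : ℝ, 0 < A ∧ (⨆ j, α j) ≤ A ∧ (β = τ → q * A * β < 1) := by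
    by_cases h : β = τ
    · have h1 := hqα h
      have h2 : (⨆ j, α j) < 1 / (q * β) := by
        rw [lt_div_iff₀ (by positivity)]
        linarith
      obtain ⟨A, h3, h4⟩ := exists_between h2
      refine ⟨A, hsup0.trans_lt h3, h3.le, fun _ => ?_⟩
      rw [lt_div_iff₀ (by positivity)] at h4
      linarith
    · exact ⟨(⨆ j, α j) + 1, by linarith, by linarith, fun h' => absurd h' h⟩
  have hαA : ∀ j, α j ≤ A := fun j => (le_ciSup hbdd j).trans hsupA
  have hint := integrable_exp_abs_rpow_betaDensity hτ hτβ (mul_pos hq0 hA) hAβ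
  have hexp := fun s => integral_exp_sum_le hφ hq0 hτ hA hint hα hαA hαsum s
  set E := Real.exp ((∑' j, α j) *
    (((∫ x, Real.exp (q * A * |x| ^ τ) ∂(densityMeasure (betaDensity β))) - 1) / A)) with hE
  have hE0 : 0 < E := Real.exp_pos _
  obtain ⟨L, M, hM, hLG, hL⟩ := G.exists_clm
  -- The summand `1` keeps `C` positive when `G` or `K` vanishes. `M`, `K` and `E` involve neither
  -- `s`, `p` nor `v`.
  refine ⟨M * |K| * E ^ (1 / q) + 1, by positivity, fun s p hp f hf => ?_⟩
  obtain ⟨F, hF, hF0, hFb⟩ := hp.exists_mixChain hφ hq hb (hexp s).1 (hexp s).2 L hM hL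
  have hfF : f = F ∅ := by
    rw [hF0]
    funext x
    rw [hf x, hLG]
  rw [hfF]
  refine ⟨hF.memWMix hφ hq, fun v => ?_, hF.anovaSupNorm_pos hφ hq, fun P hP0 hP Γ hΓ => ?_⟩
  · obtain ⟨h1, h2⟩ := hF.chainAnova hφ hq v
    exact h2 ▸ h1.memWMix hφ hq
  refine ⟨fun j hj => by rw [hΓ j]; positivity, fun v => ?_⟩
  have hX : 0 ≤ (v.card.factorial : ℝ) ^ σ * ∏ j ∈ v, b j :=
    mul_nonneg (Real.rpow_nonneg (by positivity) _) (Finset.prod_nonneg fun j _ => hb j)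
  -- The factor `(P + 1) ^ (1 / q)` of each `Γ j` absorbs the `q`-th root of the binomial sum.
  have hΓv : ∏ j ∈ v, Γ j = ((P + 1) ^ v.card) ^ (1 / q) * ∏ j ∈ v, b j := by
    simp_rw [hΓ]
    rw [Finset.prod_mul_distrib, Finset.prod_const, ← Real.rpow_natCast, ← Real.rpow_natCast,
      ← Real.rpow_mul (by positivity), ← Real.rpow_mul (by positivity), mul_comm (1 / q)]
  have hmain : mixNorm (betaDensity β) q (anovaTerm (betaDensity β) v (F ∅)) ≤
      (M * |K| * E ^ (1 / q) + 1) * (v.card.factorial : ℝ) ^ σ * ∏ j ∈ v, Γ j := by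
    have hB : 0 ≤ M * |K| * ((v.card.factorial : ℝ) ^ σ * ∏ j ∈ v, b j) := by positivity
    calc mixNorm (betaDensity β) q (anovaTerm (betaDensity β) v (F ∅))
        ≤ ((P + 1) ^ v.card * ∫ x, |F v x| ^ q ∂(productMeasure (betaDensity β) s)) ^ (1 / q) :=
          hF.mixNorm_anovaTerm_le hφ hq hP0 hP v
      _ ≤ ((P + 1) ^ v.card *
            ((M * |K| * ((v.card.factorial : ℝ) ^ σ * ∏ j ∈ v, b j)) ^ q * E)) ^ (1 / q) := by
          refine Real.rpow_le_rpow (mul_nonneg (by positivity)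
            (integral_nonneg fun x => by positivity)) ?_ (by positivity)
          exact mul_le_mul_of_nonneg_left (hFb v) (by positivity)
      _ = M * |K| * E ^ (1 / q) *
            (((P + 1) ^ v.card) ^ (1 / q) * ((v.card.factorial : ℝ) ^ σ * ∏ j ∈ v, b j)) := by
          rw [Real.mul_rpow (by positivity) (by positivity),
            Real.mul_rpow (by positivity) hE0.le, one_div, Real.rpow_rpow_inv hB hq0.ne']
          ring
      _ ≤ (M * |K| * E ^ (1 / q) + 1) *
            (((P + 1) ^ v.card) ^ (1 / q) * ((v.card.factorial : ℝ) ^ σ * ∏ j ∈ v, b j)) :=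
          mul_le_mul_of_nonneg_right (by linarith) (by positivity)
      _ = _ := by rw [hΓv]; ring
  refine ⟨hmain, fun h0 => ?_⟩
  have hS := hF.anovaSupNorm_pos hφ hq h0
  rw [anovaWeight, if_pos hS]
  calc (anovaSupNorm (betaDensity β) q (F ∅))⁻¹ *
        mixNorm (betaDensity β) q (anovaTerm (betaDensity β) v (F ∅))
      ≤ (anovaSupNorm (betaDensity β) q (F ∅))⁻¹ *
          ((M * |K| * E ^ (1 / q) + 1) * (v.card.factorial : ℝ) ^ σ * ∏ j ∈ v, Γ j) :=
        mul_le_mul_of_nonneg_left hmain (inv_nonneg.mpr hS.le)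
    _ = _ := by ring
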